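/- Let $M\ge 2$ be an integer and $p\in(1/M^2,1]$. Consider fractal percolation in $J=[0,1]^2$ with parameters $M$ and $p$: set $F_0:=J$; given $F_{n-1}$, a union of surviving closed squares of side length $M^{-(n-1)}$, divide each surviving square into $M^2$ closed subsquares of side length $M^{-n}$, keep each of these with probability $p$ independently of all other subsquares and of the previous steps, and let $F_n$ be the union of the squares kept; let $F:=\bigcap_{n} F_n$. Let $V_0,V_1,V_2$ be the intrinsic volumes on finite unions of compact convex subsets of $\mathbb{R}^2$, that is, the additive extensions (with $V_k(\emptyset)=0$) of the functionals determined on compact convex sets $K$ by the Steiner formula $\mathrm{area}\{x:\mathrm{dist}(x,K)\le\varepsilon\}=V_2(K)+2\varepsilon V_1(K)+\pi\varepsilon^2V_0(K)$, $\varepsilon\ge 0$ (so $V_2$ is the area, $V_1$ half the boundary length for sets that are the closure of their interior, and $V_0$ the Euler characteristic). Put $D:=\log(M^2p)/\log M$. Then, for $k=0,1,2$, the random variables $V_k(F_n)$ are integrable and the limit $$\overline{\mathcal V}_k(F):=\lim_{n\to\infty} M^{-n(D-k)}\,\mathbb{E}\,V_k(F_n)$$ exists, and $$\overline{\mathcal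 V}_2(F)=1,\qquad \overline{\mathcal V}_1(F)=\frac{2M(1-p)}{M-p},$$ $$\overline{\mathcal V}_0(F)=1-\frac{2p(M-1)^2}{M-p}\left(\frac{3}{M-1}-\frac{4p}{M-p}+\frac{p^2}{M-p^2}\right)+\frac{2p(M^2-1)}{M^2-p}-\frac{4p^2(M-1)^2}{(M-p)^2}+\frac{p^3(M-1)^2(M+p^2)}{(M-p^2)(M^2-p^3)}.$$ -/

import Mathlib

open MeasureTheory ProbabilityTheory Filter Topology

namespace FractalPercolation

/-! ### Intrinsic volumes on the convex ring of `ℝ^d` -/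

/-- The volume `κ_j` of the unit ball of `ℝ^j` (so `κ_0 = 1`, `κ_1 = 2`, `κ_2 = π`). -/
noncomputable def kappa (j : ℕ) : ℝ :=
  (volume (Metric.closedBall (0 : EuclideanSpace ℝ (Fin j)) 1)).toReal

/-- `v 0, …, v d` are the coefficients of the Steiner formula for `K ⊆ ℝ^d`:
`vol {x | dist(x, K) ≤ ε} = ∑_{k ≤ d} κ_{d-k} ε^{d-k} v_k` for all `ε ≥ 0`.
These coefficients are unique, and they exist if `K` is compact and convex (all of them are `0`
if `K` is empty). -/
def IsSteinerCoeff {d : ℕ} (K : Set (EuclideanSpace ℝ (Fin d))) (v : Fin (d + 1) → ℝ) : Prop :=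
  ∀ ε : ℝ, 0 ≤ ε →
    (volume (Metric.cthickening ε K)).toReal =
      ∑ k : Fin (d + 1), kappa (d - (k : ℕ)) * ε ^ (d - (k : ℕ)) * v k

/-- `v` is obtained by additive extension of the Steiner coefficients to the polyconvex set `K`:
`K = C_1 ∪ … ∪ C_m` with compact convex sets `C_i`, and by inclusion-exclusion
`v = ∑_{∅ ≠ t ⊆ {1,…,m}} (-1)^{|t|-1} w_t`, where `w_t` are the Steiner coefficients of the compact
convex set `⋂_{i ∈ t} C_i`. -/
def HasIntrinsicVolumes {d : ℕ} (K : Set (EuclideanSpace ℝ (Fin d))) (v : Fin (d + 1) → ℝ) :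
    Prop :=
  ∃ (m : ℕ) (C : Fin m → Set (EuclideanSpace ℝ (Fin d)))
    (w : Finset (Fin m) → Fin (d + 1) → ℝ),
    (∀ i, IsCompact (C i) ∧ Convex ℝ (C i)) ∧
    K = ⋃ i, C i ∧
    (∀ t : Finset (Fin m), t.Nonempty → IsSteinerCoeff (⋂ i ∈ t, C i) (w t)) ∧
    ∀ k, v k = ∑ t ∈ Finset.univ.filter (fun t : Finset (Fin m) => t.Nonempty),
      (-1 : ℝ) ^ (t.card - 1) * w t k

open Classical in
/-- The `k`-th intrinsic volume `V_k(K)` of a polyconvex set `K ⊆ ℝ^d`, that is, the additive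
extension of the `k`-th Steiner coefficient to finite unions of compact convex sets
(the value does not depend on the representation as a union). It is `0` by convention
on sets that are not polyconvex. -/
noncomputable def intrinsicVolume {d : ℕ} (k : Fin (d + 1)) (K : Set (EuclideanSpace ℝ (Fin d))) :
    ℝ :=
  if h : ∃ v, HasIntrinsicVolumes K v then h.choose k else 0

/-! ### Fractal percolation in `[0,1]^d` -/

/-- The unit cube `J = [0,1]^d`. -/
def unitCube (d : ℕ) : Set (EuclideanSpace ℝ (Fin d)) :=
  {x | ∀ j, x j ∈ Set.Icc (0 : ℝ) 1}

/-- The indices of the `M^d` subcubes of side length `1/M` into which the unit cube is divided. -/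
abbrev Letter (d M : ℕ) : Type := Fin d → Fin M

/-- The similarity `φ_a`, `x ↦ (x + a)/M`, mapping `J` to the subcube `J_a`. -/
noncomputable def phi {d M : ℕ} (a : Letter d M) (x : EuclideanSpace ℝ (Fin d)) :
    EuclideanSpace ℝ (Fin d) :=
  WithLp.toLp 2 (fun j => (x j + ((a j : ℕ) : ℝ)) / (M : ℝ))

/-- The cube `J_σ = φ_{σ_1} ∘ … ∘ φ_{σ_n} (J)` of side length `M^{-n}`, for a word
`σ = σ_1 … σ_n`. -/
noncomputable def cube {d M : ℕ} : List (Letter d M) → Set (EuclideanSpace ℝ (Fin d))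
  | [] => unitCube d
  | a :: σ => phi a '' cube σ

/-- `keep σ a` is the event that the subcube `J_{σa}` of `J_σ` is kept when `J_σ` is subdivided.
In fractal percolation with parameters `M` and `p`, each subcube is kept with probability `p`,
independently of all other subcubes of all levels. -/
structure IsPercolation {Ω : Type*} [MeasurableSpace Ω] (P : Measure Ω) {d M : ℕ} (p : ℝ)
    (keep : List (Letter d M) → Letter d M → Set Ω) : Prop where
  measurableSet : ∀ σ a, MeasurableSet (keep σ a)
  prob : ∀ σ a, P (keep σ a) = ENNReal.ofReal p
  indep : iIndepSet (fun q : List (Letter d M) × Letter d M => keep q.1 q.2) P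

/-- The `n`-th generation `𝒯_n` of the random tree of surviving words: `𝒯_0` consists of
the empty word, and `𝒯_{n+1}` of the words `σa` with `σ ∈ 𝒯_n` for which `J_{σa}` is kept. -/
def tree {Ω : Type*} {d M : ℕ} (keep : List (Letter d M) → Letter d M → Set Ω) (ω : Ω) :
    ℕ → Set (List (Letter d M))
  | 0 => {[]}
  | n + 1 => {τ | ∃ σ ∈ tree keep ω n, ∃ a, ω ∈ keep σ a ∧ τ = σ ++ [a]}

/-- The `n`-th construction step `F_n = ⋃_{σ ∈ 𝒯_n} J_σ` of fractal percolation. -/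
def step {Ω : Type*} {d M : ℕ} (keep : List (Letter d M) → Letter d M → Set Ω) (n : ℕ) (ω : Ω) :
    Set (EuclideanSpace ℝ (Fin d)) :=
  ⋃ σ ∈ tree keep ω n, cube σ

/-- The dimension `D = log (M^d p) / log M` of fractal percolation. -/
noncomputable def dimD (d M : ℕ) (p : ℝ) : ℝ :=
  Real.log ((M : ℝ) ^ d * p) / Real.log (M : ℝ)

/-- The rescaled expected intrinsic volume `r^{n(D-k)} 𝔼 V_k(F_n)` with `r = 1/M`. -/
noncomputable def rescaledVolume {Ω : Type*} [MeasurableSpace Ω] (P : Measure Ω) {d M : ℕ} (p : ℝ)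
    (keep : List (Letter d M) → Letter d M → Set Ω) (k : Fin (d + 1)) (n : ℕ) : ℝ :=
  (1 / (M : ℝ)) ^ ((n : ℝ) * (dimD d M p - ((k : ℕ) : ℝ))) *
    ∫ ω, intrinsicVolume k (step keep n ω) ∂P

end FractalPercolation

/-! The expectation of `V_k(F_n)` reduces to counting small configurations of surviving squares, and
each count obeys a linear recursion in `n`.

Geometry. Near a point of the plane at most four squares of the grid meet. Inclusion-exclusion over
them, with sets of squares grouped by their common intersection, writes the indicator of a union of
grid squares as squares, minus edges between neighbouring present squares, plus a correction at each
inner vertex (`ind_union_gridSquare`). The sets of squares that meet only in the vertex are those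
occupying both columns and both rows around it: two diagonals, four triples and the full quadruple,
whence the seven patterns of `vertexPattern`.

This identity gives the intrinsic volumes once these are known to depend linearly on indicators,
whatever representation of the set was chosen. Slicing along the coordinates shows this for the
Euler characteristic (`sum_ind_nonempty_eq_zero`). Integrating the Euler characteristic of `K ∩ B(x,
ε)` over `x` gives the volume of the parallel set of `K`, hence the result for all Steiner
coefficients (`sum_steinerCoeff_eq_zero`, `intrinsicVolume_eq`). The Steiner coefficients of boxes
are computed by Fubini.

Probability. A set of squares survives with probability `p` to the number of distinct branchings
above it. Passing to parent squares, a pair of neighbours or a vertex pattern lands in one parent,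
in two neighbouring parents, or in the same pattern one level up. The resulting recursions, divided
by the expected number `(M²p)^n` of squares, are contractions with converging inhomogeneity
(`tendsto_of_recursion`). If `h`, `v`, `y_t` are the normalized limits for horizontal pairs,
vertical pairs and vertex patterns, the three answers are `1`, `2 - h - v` and `1 - h - v + ∑ ±
y_t`. -/

namespace FractalPercolation

/-! ### The Euler characteristic and uniqueness of intrinsic volumes -/

open Classical in
/-- The indicator of a proposition as a real number. -/
noncomputable def ind (q : Prop) : ℝ := if q then 1 else 0

lemma ind_true {q : Prop} (h : q) : ind q = 1 := if_pos h

lemma ind_false {q : Prop} (h : ¬ q) : ind q = 0 := if_neg h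

/-- The one-dimensional Euler characteristic is a sum of jumps: the value at `t` minus the limit
from the right counts exactly the nonempty intervals with right endpoint `t`, and every nonempty
interval has one right endpoint. -/
lemma sum_eq_zero_of_sum_ind_Icc {ι : Type*} [Fintype ι] (α a b : ι → ℝ) (q : ι → Prop)
    (hab : ∀ i, q i → a i ≤ b i)
    (h : ∀ t, ∑ i, α i * ind (q i ∧ t ∈ Set.Icc (a i) (b i)) = 0) :
    ∑ i, α i * ind (q i) = 0 := by
  classical
  have right : ∀ t, ∑ i, α i * ind (q i ∧ t ∈ Set.Ico (a i) (b i)) = 0 := by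
    intro t
    have ev : ∀ i, ∀ᶠ y in 𝓝[>] t,
        (y ∈ Set.Icc (a i) (b i) ↔ t ∈ Set.Ico (a i) (b i)) := by
      intro i
      have hy : ∀ᶠ y in 𝓝[>] t, t < y := eventually_mem_nhdsWithin
      have ha : ∀ᶠ y in 𝓝[>] t, (a i ≤ y ↔ a i ≤ t) := by
        rcases le_or_gt (a i) t with h1 | h1
        · filter_upwards [hy] with y hy
          exact ⟨fun _ => h1, fun _ => h1.trans hy.le⟩
        · filter_upwards [nhdsWithin_le_nhds (eventually_lt_nhds h1)] with y hy
          exact ⟨fun h => absurd h (not_le.2 hy), fun h => absurd h (not_le.2 h1)⟩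
      have hb : ∀ᶠ y in 𝓝[>] t, (y ≤ b i ↔ t < b i) := by
        rcases lt_or_ge t (b i) with h1 | h1
        · filter_upwards [nhdsWithin_le_nhds (eventually_lt_nhds h1)] with y hy
          exact ⟨fun _ => h1, fun _ => hy.le⟩
        · filter_upwards [hy] with y hy
          exact ⟨fun h => absurd (hy.trans_le h) (not_lt.2 h1), fun h => absurd h (not_lt.2 h1)⟩
      filter_upwards [ha, hb] with y h1 h2
      rw [Set.mem_Icc, Set.mem_Ico, h1, h2]
    obtain ⟨y, hy⟩ := (eventually_all.2 ev).exists
    rw [← h y]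
    refine Finset.sum_congr rfl fun i _ => ?_
    rw [hy i]
  have endpt : ∀ t, ∑ i, α i * ind (q i ∧ b i = t) = 0 := by
    intro t
    rw [← sub_zero (0 : ℝ)]
    nth_rewrite 1 [← h t]
    rw [← right t, ← Finset.sum_sub_distrib]
    refine Finset.sum_congr rfl fun i _ => ?_
    rw [← mul_sub]
    congr 1
    by_cases hq : q i
    · have := hab i hq
      simp only [ind, Set.mem_Icc, Set.mem_Ico, hq, true_and]
      split_ifs <;> grind
    · simp [ind, hq]
  have key : ∀ i, α i * ind (q i) = ∑ t ∈ Finset.univ.image b, α i * ind (q i ∧ b i = t) := by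
    intro i
    rw [Finset.sum_eq_single (b i)]
    · simp
    · intro t _ ht
      rw [ind_false (fun h => ht h.2.symm), mul_zero]
    · intro h
      exact absurd (Finset.mem_image_of_mem b (Finset.mem_univ i)) h
  simp_rw [key]
  rw [Finset.sum_comm]
  exact Finset.sum_eq_zero fun t _ => endpt t

/-- If the sections of compact convex sets along the level sets of a linear functional have
vanishing weighted Euler characteristic, then so do the sets. -/
lemma sum_ind_nonempty_of_sections {E : Type*} [AddCommGroup E] [Module ℝ E] [TopologicalSpace E]
    {ι : Type*} [Fintype ι] (α : ι → ℝ) (K : ι → Set E)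
    (hK : ∀ i, IsCompact (K i) ∧ Convex ℝ (K i)) (L : E →L[ℝ] ℝ)
    (h : ∀ t, ∑ i, α i * ind (K i ∩ {x | L x = t}).Nonempty = 0) :
    ∑ i, α i * ind (K i).Nonempty = 0 := by
  have hex : ∀ i, ∃ a b : ℝ, (K i).Nonempty → a ≤ b ∧ L '' K i = Set.Icc a b := by
    intro i
    by_cases hne : (K i).Nonempty
    · have hc : IsCompact (L '' K i) := (hK i).1.image L.continuous
      have hconv : Convex ℝ (L '' K i) := (hK i).2.linear_image L.toLinearMap
      have hn : (L '' K i).Nonempty := hne.image L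
      have hconn : IsConnected (L '' K i) := ⟨hn, hconv.isPreconnected⟩
      refine ⟨sInf (L '' K i), sSup (L '' K i), fun _ => ⟨?_, eq_Icc_of_connected_compact hconn hc⟩⟩
      exact csInf_le_csSup hn hc.bddBelow hc.bddAbove
    · exact ⟨0, 0, fun h => absurd h hne⟩
  choose a b hab using hex
  refine sum_eq_zero_of_sum_ind_Icc α a b _ (fun i hi => (hab i hi).1) fun t => ?_
  rw [← h t]
  refine Finset.sum_congr rfl fun i _ => ?_
  congr 2
  apply propext
  constructor
  · rintro ⟨hne, ht⟩
    rw [← (hab i hne).2] at ht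
    obtain ⟨x, hx, rfl⟩ := ht
    exact ⟨x, hx, rfl⟩
  · rintro ⟨x, hx, hxt⟩
    refine ⟨⟨x, hx⟩, ?_⟩
    rw [← (hab i ⟨x, hx⟩).2]
    exact ⟨x, hx, hxt⟩

/-- The Euclidean plane. -/
abbrev Plane : Type := EuclideanSpace ℝ (Fin 2)

/-- The coordinate functionals of the plane. -/
noncomputable def coord (k : Fin 2) : Plane →L[ℝ] ℝ := EuclideanSpace.proj k

/-- The Euler characteristic is well defined on linear combinations of indicators of compact convex
sets in the plane. -/
lemma sum_ind_nonempty_eq_zero {ι : Type*} [Fintype ι] (α : ι → ℝ) (K : ι → Set Plane)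
    (hK : ∀ i, IsCompact (K i) ∧ Convex ℝ (K i)) (h : ∀ x, ∑ i, α i * ind (x ∈ K i) = 0) :
    ∑ i, α i * ind (K i).Nonempty = 0 := by
  have hsec : ∀ (k : Fin 2) (t : ℝ) (C : Set Plane), IsCompact C ∧ Convex ℝ C →
      IsCompact (C ∩ {x | coord k x = t}) ∧ Convex ℝ (C ∩ {x | coord k x = t}) := by
    intro k t C hC
    refine ⟨hC.1.inter_right (isClosed_eq (coord k).continuous continuous_const), hC.2.inter ?_⟩
    have := (convex_singleton (𝕜 := ℝ) t).linear_preimage (coord k).toLinearMap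
    exact this
  -- Slicing by both coordinates leaves sets with at most one point, for which nonemptiness is
  -- membership and the hypothesis applies.
  refine sum_ind_nonempty_of_sections α K hK (coord 0) fun t => ?_
  refine sum_ind_nonempty_of_sections α _ (fun i => hsec 0 t _ (hK i)) (coord 1) fun s => ?_
  rw [← h !₂[t, s]]
  refine Finset.sum_congr rfl fun i _ => ?_
  congr 2
  apply propext
  constructor
  · rintro ⟨x, ⟨hx, h0⟩, h1⟩
    have : x = !₂[t, s] := by
      ext k
      fin_cases k
      · exact h0
      · exact h1
    rwa [← this]
  · intro hx
    exact ⟨_, ⟨hx, by simp [coord]⟩, by simp [coord]⟩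

lemma kappa_pos (j : ℕ) : 0 < kappa j := by
  refine ENNReal.toReal_pos ?_ ?_
  · exact (Metric.measure_closedBall_pos volume _ one_pos).ne'
  · exact (isCompact_closedBall _ _).measure_lt_top.ne

lemma kappa_zero : kappa 0 = 1 := by
  have : Metric.closedBall (0 : EuclideanSpace ℝ (Fin 0)) 1 = {0} := by
    ext x
    simp [Subsingleton.elim x 0]
  rw [kappa, this, volume_euclideanSpace_eq_dirac]
  simp

lemma kappa_one : kappa 1 = 2 := by
  rw [kappa, InnerProductSpace.volume_closedBall_of_dim_odd (k := 0) (by simp)]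
  simp

/-- Turns the indicator of a parallel set at `x` into the Euler characteristic of the convex set `C
∩ B(x, ε)`. -/
lemma mem_cthickening_iff_nonempty {C : Set Plane} (hC : IsCompact C) {ε : ℝ} (hε : 0 ≤ ε)
    (x : Plane) : x ∈ Metric.cthickening ε C ↔ (C ∩ Metric.closedBall x ε).Nonempty := by
  rw [hC.cthickening_eq_biUnion_closedBall hε]
  simp only [Set.mem_iUnion, Metric.mem_closedBall, exists_prop]
  exact ⟨fun ⟨y, hy, h⟩ => ⟨y, hy, by rwa [Metric.mem_closedBall, dist_comm]⟩,
    fun ⟨y, hy, h⟩ => ⟨y, hy, by rwa [Metric.mem_closedBall, dist_comm] at h⟩⟩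

/-- Steiner coefficients respect linear relations between indicators of compact convex sets. -/
lemma sum_steinerCoeff_eq_zero {ι : Type*} [Fintype ι] (α : ι → ℝ) (C : ι → Set Plane)
    (w : ι → Fin 3 → ℝ) (hC : ∀ i, IsCompact (C i) ∧ Convex ℝ (C i))
    (hw : ∀ i, IsSteinerCoeff (C i) (w i)) (h : ∀ x, ∑ i, α i * ind (x ∈ C i) = 0) (k : Fin 3) :
    ∑ i, α i * w i k = 0 := by
  have vol : ∀ ε : ℝ, 0 ≤ ε → ∑ i, α i * (volume (Metric.cthickening ε (C i))).toReal = 0 := by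
    intro ε hε
    have hms : ∀ i, MeasurableSet (Metric.cthickening ε (C i)) := fun i =>
      Metric.isClosed_cthickening.measurableSet
    have hfin : ∀ i, volume (Metric.cthickening ε (C i)) ≠ ⊤ := fun i =>
      (hC i).1.cthickening.measure_lt_top.ne
    have hpt : ∀ x, ∑ i, α i * (Metric.cthickening ε (C i)).indicator (fun _ => (1 : ℝ)) x = 0 := by
      intro x
      -- Intersecting with a fixed ball preserves the linear relation as well as compactness and
      -- convexity, so the relation passes to the parallel sets pointwise and can be integrated.
      rw [← sum_ind_nonempty_eq_zero α (fun i => C i ∩ Metric.closedBall x ε)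
        (fun i => ⟨(hC i).1.inter_right Metric.isClosed_closedBall,
          (hC i).2.inter (convex_closedBall x ε)⟩) ?_]
      · refine Finset.sum_congr rfl fun i _ => ?_
        congr 1
        by_cases hx : x ∈ Metric.cthickening ε (C i)
        · rw [Set.indicator_of_mem hx,
            ind_true ((mem_cthickening_iff_nonempty (hC i).1 hε x).1 hx)]
        · rw [Set.indicator_of_notMem hx,
            ind_false fun h => hx ((mem_cthickening_iff_nonempty (hC i).1 hε x).2 h)]
      · intro y
        by_cases hy : y ∈ Metric.closedBall x ε
        · simpa only [Set.mem_inter_iff, hy, and_true] using h y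
        · simp [ind, hy]
    have hint : ∀ i, ∫ x, α i * (Metric.cthickening ε (C i)).indicator (fun _ => (1 : ℝ)) x =
        α i * (volume (Metric.cthickening ε (C i))).toReal := by
      intro i
      rw [integral_const_mul, integral_indicator (hms i)]
      simp [Measure.real]
    simp_rw [← hint]
    rw [← integral_finsetSum]
    · simp_rw [hpt]
      simp
    · intro i _
      exact ((integrable_indicator_iff (hms i)).2
        (integrableOn_const (hfin i) (by simp))).const_mul _
  have poly : ∀ ε : ℝ, 0 ≤ ε → kappa 2 * ε ^ 2 * (∑ i, α i * w i 0) +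
      kappa 1 * ε * (∑ i, α i * w i 1) + kappa 0 * (∑ i, α i * w i 2) = 0 := by
    intro ε hε
    rw [← vol ε hε]
    simp_rw [Finset.mul_sum]
    rw [← Finset.sum_add_distrib, ← Finset.sum_add_distrib]
    refine Finset.sum_congr rfl fun i _ => ?_
    rw [hw i ε hε, Fin.sum_univ_three]
    simp only [Fin.val_zero, Fin.val_one, Fin.val_two, Nat.sub_zero, Nat.sub_self,
      Nat.reduceSub, pow_one, pow_zero]
    ring
  -- Three values of `ε` determine the quadratic: `ε = 0` isolates the constant term, and `p2 - 2 *
  -- p1` then removes the linear one.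
  have p0 := poly 0 le_rfl
  have p1 := poly 1 zero_le_one
  have p2 := poly 2 zero_le_two
  have k2 := kappa_pos 2
  rw [kappa_zero, kappa_one] at p0 p1 p2
  have e2 : ∑ i, α i * w i 2 = 0 := by linarith
  have e0 : kappa 2 * ∑ i, α i * w i 0 = 0 := by linarith
  have e0 := (mul_eq_zero.1 e0).resolve_left k2.ne'
  have e1 : ∑ i, α i * w i 1 = 0 := by
    rw [e0, e2] at p1
    linarith
  fin_cases k
  · exact e0
  · exact e1
  · exact e2

/-- The linear span of the pairs formed by the indicator of a compact convex set of the plane and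
its Steiner coefficients. -/
noncomputable def valuationGraph : Submodule ℝ ((Plane → ℝ) × (Fin 3 → ℝ)) :=
  Submodule.span ℝ {q | ∃ (C : Set Plane) (w : Fin 3 → ℝ), IsCompact C ∧ Convex ℝ C ∧
    IsSteinerCoeff C w ∧ q = (fun x => ind (x ∈ C), w)}

lemma mem_valuationGraph {C : Set Plane} {w : Fin 3 → ℝ} (h1 : IsCompact C) (h2 : Convex ℝ C)
    (h3 : IsSteinerCoeff C w) : ((fun x => ind (x ∈ C)), w) ∈ valuationGraph :=
  Submodule.subset_span ⟨C, w, h1, h2, h3, rfl⟩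

/-- The span is the graph of a function: a difference `(0, u - v)` is a finite combination of
generators whose indicators cancel, so its Steiner coefficients cancel too. -/
lemma valuationGraph_unique {f : Plane → ℝ} {u v : Fin 3 → ℝ} (hu : (f, u) ∈ valuationGraph)
    (hv : (f, v) ∈ valuationGraph) : u = v := by
  have h := Submodule.sub_mem _ hu hv
  rw [Prod.mk_sub_mk, sub_self] at h
  obtain ⟨n, α, g, hg⟩ := Submodule.mem_span_set'.1 h
  choose C w h1 h2 h3 h4 using fun i => (g i).2
  have hfst : ∀ x, ∑ i, α i * ind (x ∈ C i) = 0 := by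
    intro x
    have := congrFun (congrArg Prod.fst hg) x
    simpa [Prod.fst_sum, Finset.sum_apply, h4] using this
  ext k
  have hsnd := congrFun (congrArg Prod.snd hg) k
  simp only [Prod.snd_sum, Prod.smul_snd, h4, Finset.sum_apply, Pi.smul_apply, smul_eq_mul,
    Pi.sub_apply] at hsnd
  rw [sum_steinerCoeff_eq_zero α C w (fun i => ⟨h1 i, h2 i⟩) h3 hfst k] at hsnd
  linarith

lemma HasIntrinsicVolumes.mem_valuationGraph {K : Set Plane} {v : Fin 3 → ℝ}
    (h : HasIntrinsicVolumes K v) : ((fun x => ind (x ∈ K)), v) ∈ valuationGraph := by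
  obtain ⟨m, C, w, hC, rfl, hw, hv⟩ := h
  have hsum : ((fun x => ind (x ∈ ⋃ i, C i)), v) =
      ∑ t ∈ Finset.univ.filter (fun t : Finset (Fin m) => t.Nonempty),
        (-1 : ℝ) ^ (t.card - 1) • ((fun x => ind (x ∈ ⋂ i ∈ t, C i)), w t) := by
    refine Prod.ext ?_ ?_
    · ext x
      have := Finset.indicator_biUnion_eq_sum_powerset Finset.univ C (fun _ => (1 : ℝ)) x
      simp only [Finset.mem_univ, Set.iUnion_true, Finset.powerset_univ] at this
      simp only [Prod.fst_sum, Prod.smul_fst, Finset.sum_apply, Pi.smul_apply, smul_eq_mul]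
      have hi : ∀ S : Set Plane, S.indicator (fun _ => (1 : ℝ)) x = ind (x ∈ S) := by
        intro S
        simp only [Set.indicator, ind]
      simp only [hi] at this
      rw [this]
      refine Finset.sum_congr rfl fun t ht => ?_
      -- The definition has the sign exponent `t.card - 1` with truncated subtraction, which is
      -- harmless because `t` is nonempty.
      have : 1 ≤ t.card := (Finset.mem_filter.1 ht).2.card_pos
      obtain ⟨c, hc⟩ := Nat.exists_eq_add_of_le' this
      rw [hc]
      simp [pow_succ]
    · ext k
      simp only [Prod.snd_sum, Prod.smul_snd, Finset.sum_apply, Pi.smul_apply, smul_eq_mul]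
      exact hv k
  rw [hsum]
  refine Submodule.sum_mem _ fun t ht => Submodule.smul_mem _ _ ?_
  have htn := (Finset.mem_filter.1 ht).2
  refine FractalPercolation.mem_valuationGraph ?_ (convex_iInter₂ fun i _ => (hC i).2) (hw t htn)
  obtain ⟨i, hi⟩ := htn
  exact (hC i).1.of_isClosed_subset (isClosed_biInter fun j _ => (hC j).1.isClosed)
    (Set.biInter_subset_of_mem hi)

/-- The intrinsic volumes of a polyconvex set can be computed from any representation of its
indicator as a linear combination of indicators of compact convex sets. -/
lemma intrinsicVolume_eq {K : Set Plane} {v : Fin 3 → ℝ} (h : ∃ u, HasIntrinsicVolumes K u)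
    (hv : ((fun x => ind (x ∈ K)), v) ∈ valuationGraph) (k : Fin 3) :
    intrinsicVolume k K = v k := by
  rw [intrinsicVolume, dif_pos h,
    valuationGraph_unique h.choose_spec.mem_valuationGraph hv]

/-! ### Steiner formula for boxes -/

/-- The closed box `[a, b] × [c, d]`. -/
def box (a b c d : ℝ) : Set Plane := {x | x 0 ∈ Set.Icc a b ∧ x 1 ∈ Set.Icc c d}

/-- The distance of `x` to the interval `[a, b]`. -/
noncomputable def distIcc (a b x : ℝ) : ℝ := max (max (a - x) (x - b)) 0

lemma distIcc_nonneg (a b x : ℝ) : 0 ≤ distIcc a b x := le_max_right _ _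

lemma measurable_distIcc (a b : ℝ) : Measurable (distIcc a b) := by
  unfold distIcc
  fun_prop

lemma distIcc_le_abs {a b y : ℝ} (x : ℝ) (hy : y ∈ Set.Icc a b) : distIcc a b x ≤ |x - y| := by
  rw [distIcc, max_le_iff, max_le_iff]
  exact ⟨⟨by linarith [neg_abs_le (x - y), hy.1], by linarith [le_abs_self (x - y), hy.2]⟩,
    abs_nonneg _⟩

lemma exists_abs_eq_distIcc {a b : ℝ} (hab : a ≤ b) (x : ℝ) :
    ∃ y ∈ Set.Icc a b, |x - y| = distIcc a b x := by
  refine ⟨max a (min x b), ⟨le_max_left _ _, max_le hab (min_le_right _ _)⟩, ?_⟩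
  unfold distIcc
  grind

lemma setOf_distIcc_sq_le (a b : ℝ) {r : ℝ} (hr : 0 ≤ r) :
    {x | distIcc a b x ^ 2 ≤ r} = Set.Icc (a - √r) (b + √r) := by
  ext x
  have h0 := Real.sqrt_nonneg r
  rw [Set.mem_ofPred_eq, ← Real.le_sqrt (distIcc_nonneg a b x) hr, distIcc, max_le_iff,
    max_le_iff, Set.mem_Icc]
  constructor
  · rintro ⟨⟨h1, h2⟩, -⟩
    constructor <;> linarith
  · rintro ⟨h1, h2⟩
    refine ⟨⟨?_, ?_⟩, h0⟩ <;> linarith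

/-- Compares an interval with a single point, so that the sides of a box can be collapsed one at a
time. The indicator covers negative `r`, where both sets are empty. -/
lemma volume_distIcc_sq_le {a b : ℝ} (hab : a ≤ b) (r : ℝ) :
    volume {x | distIcc a b x ^ 2 ≤ r} =
      (Set.Ici (0 : ℝ)).indicator (fun _ => ENNReal.ofReal (b - a)) r +
        volume {x | distIcc 0 0 x ^ 2 ≤ r} := by
  rcases le_or_gt 0 r with hr | hr
  · have h0 := Real.sqrt_nonneg r
    rw [setOf_distIcc_sq_le a b hr, setOf_distIcc_sq_le 0 0 hr, Real.volume_Icc,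
      Real.volume_Icc, Set.indicator_of_mem (Set.mem_Ici.2 hr),
      ← ENNReal.ofReal_add (by linarith) (by linarith)]
    congr 1
    ring
  · have : ∀ a b : ℝ, {x | distIcc a b x ^ 2 ≤ r} = ∅ := fun a b => by
      ext x
      simp only [Set.mem_ofPred_eq, Set.mem_empty_iff_false, iff_false, not_le]
      exact hr.trans_le (sq_nonneg _)
    simp [this, hr]

/-- The parallel set of `[a, b] × [c, d]` at distance `ε`, in coordinates. -/
def parallelBox (a b c d ε : ℝ) : Set (ℝ × ℝ) :=
  {q | distIcc a b q.1 ^ 2 + distIcc c d q.2 ^ 2 ≤ ε ^ 2}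

lemma measurableSet_parallelBox (a b c d ε : ℝ) : MeasurableSet (parallelBox a b c d ε) := by
  refine measurableSet_le ?_ measurable_const
  exact (((measurable_distIcc a b).comp measurable_fst).pow_const 2).add
    (((measurable_distIcc c d).comp measurable_snd).pow_const 2)

/-- By Fubini, each horizontal slice that meets the parallel set exceeds the slice for `a = b = 0`
by `b - a`, and the heights of these slices fill an interval of length `d - c + 2 * ε`. -/
lemma volume_parallelBox_left {a b c d ε : ℝ} (hab : a ≤ b) (hε : 0 ≤ ε) :
    volume (parallelBox a b c d ε) = ENNReal.ofReal (b - a) * ENNReal.ofReal (d - c + 2 * ε) +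
      volume (parallelBox 0 0 c d ε) := by
  have slice : ∀ a b : ℝ, volume (parallelBox a b c d ε) =
      ∫⁻ y, volume {x | distIcc a b x ^ 2 ≤ ε ^ 2 - distIcc c d y ^ 2} := by
    intro a b
    rw [Measure.volume_eq_prod, Measure.prod_apply_symm (measurableSet_parallelBox a b c d ε)]
    refine lintegral_congr fun y => ?_
    congr 1
    ext x
    simp only [parallelBox, Set.mem_preimage, Set.mem_ofPred_eq]
    constructor <;> intro h <;> linarith
  have hm : MeasurableSet {y | distIcc c d y ^ 2 ≤ ε ^ 2} :=
    measurableSet_le ((measurable_distIcc c d).pow_const 2) measurable_const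
  rw [slice, slice]
  simp_rw [volume_distIcc_sq_le hab]
  have hind : ∀ y, (Set.Ici (0 : ℝ)).indicator (fun _ => ENNReal.ofReal (b - a))
      (ε ^ 2 - distIcc c d y ^ 2) =
      {y | distIcc c d y ^ 2 ≤ ε ^ 2}.indicator (fun _ => ENNReal.ofReal (b - a)) y := by
    intro y
    simp [Set.indicator]
  simp_rw [hind]
  rw [lintegral_add_left (measurable_const.indicator hm), lintegral_indicator_const hm,
    setOf_distIcc_sq_le c d (sq_nonneg ε), Real.sqrt_sq hε, Real.volume_Icc]
  congr 3
  ring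

lemma volume_parallelBox_swap (a b c d ε : ℝ) :
    volume (parallelBox a b c d ε) = volume (parallelBox c d a b ε) := by
  have h := (Measure.measurePreserving_swap (μ := (volume : Measure ℝ))
    (ν := (volume : Measure ℝ))).measure_preimage
    (measurableSet_parallelBox a b c d ε).nullMeasurableSet
  rw [Measure.volume_eq_prod, ← h]
  congr 1
  ext q
  simp [parallelBox, add_comm]

lemma isCompact_box (a b c d : ℝ) : IsCompact (box a b c d) := by
  have h : IsCompact (Set.Icc (![a, c] : Fin 2 → ℝ) ![b, d]) := isCompact_Icc
  convert! h.image (PiLp.continuous_toLp 2 (fun _ : Fin 2 => ℝ))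
  ext x
  simp only [box, Set.mem_ofPred_eq, Set.mem_image, Set.mem_Icc, Pi.le_def, Fin.forall_fin_two]
  constructor
  · rintro ⟨h1, h2⟩
    exact ⟨x.ofLp, ⟨⟨h1.1, h2.1⟩, ⟨h1.2, h2.2⟩⟩, rfl⟩
  · rintro ⟨y, ⟨⟨h1, h2⟩, ⟨h3, h4⟩⟩, rfl⟩
    exact ⟨⟨h1, h3⟩, ⟨h2, h4⟩⟩

lemma convex_box (a b c d : ℝ) : Convex ℝ (box a b c d) := by
  have h0 := (convex_Icc (𝕜 := ℝ) a b).linear_preimage (coord 0).toLinearMap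
  have h1 := (convex_Icc (𝕜 := ℝ) c d).linear_preimage (coord 1).toLinearMap
  exact h0.inter h1

/-- The nearest point of a box is found coordinate by coordinate, so squared distances to the two
sides add. -/
lemma volume_cthickening_box {a b c d ε : ℝ} (hab : a ≤ b) (hcd : c ≤ d) (hε : 0 ≤ ε) :
    volume (Metric.cthickening ε (box a b c d)) = volume (parallelBox a b c d ε) := by
  have mp : MeasurePreserving (fun x : Plane => (x 0, x 1)) :=
    (volume_preserving_finTwoArrow ℝ).comp (PiLp.volume_preserving_ofLp (Fin 2))
  rw [← mp.measure_preimage (measurableSet_parallelBox a b c d ε).nullMeasurableSet]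
  congr 1
  ext x
  rw [mem_cthickening_iff_nonempty (isCompact_box a b c d) hε]
  simp only [parallelBox, Set.mem_preimage, Set.mem_ofPred_eq]
  have hd : ∀ y : Plane, y ∈ Metric.closedBall x ε ↔
      |x 0 - y 0| ^ 2 + |x 1 - y 1| ^ 2 ≤ ε ^ 2 := by
    intro y
    rw [Metric.mem_closedBall, dist_comm, EuclideanSpace.dist_eq, Real.sqrt_le_left hε,
      Fin.sum_univ_two, Real.dist_eq, Real.dist_eq]
  constructor
  · rintro ⟨y, ⟨h0, h1⟩, hy⟩
    refine le_trans (add_le_add ?_ ?_) ((hd y).1 hy)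
    · exact pow_le_pow_left₀ (distIcc_nonneg _ _ _) (distIcc_le_abs _ h0) 2
    · exact pow_le_pow_left₀ (distIcc_nonneg _ _ _) (distIcc_le_abs _ h1) 2
  · intro h
    obtain ⟨s, hs, hs'⟩ := exists_abs_eq_distIcc hab (x 0)
    obtain ⟨t, ht, ht'⟩ := exists_abs_eq_distIcc hcd (x 1)
    refine ⟨!₂[s, t], ⟨by simpa using hs, by simpa using ht⟩, (hd _).2 ?_⟩
    simpa [hs', ht'] using h

lemma kappa_two : kappa 2 = Real.pi := by
  rw [kappa, EuclideanSpace.volume_closedBall_fin_two]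
  simp [Real.pi_pos.le]

lemma volume_parallelBox_zero {ε : ℝ} (hε : 0 ≤ ε) :
    volume (parallelBox 0 0 0 0 ε) = ENNReal.ofReal (Real.pi * ε ^ 2) := by
  rw [← volume_cthickening_box le_rfl le_rfl hε]
  have : box 0 0 0 0 = {0} := by
    ext x
    simp only [box, Set.Icc_self, Set.mem_singleton_iff, Set.mem_ofPred_eq]
    constructor
    · rintro ⟨h0, h1⟩
      ext k
      fin_cases k
      · exact h0
      · exact h1
    · rintro rfl
      simp
  rw [this, Metric.cthickening_singleton _ hε, EuclideanSpace.volume_closedBall_fin_two,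
    ← ENNReal.ofReal_pow hε, ← ENNReal.ofReal_mul (by positivity), mul_comm]

/-- Collapsing both sides in turn gives `(b - a)(d - c + 2ε) + 2ε(d - c) + πε²`; the last term is
the disc left over. -/
lemma isSteinerCoeff_box {a b c d : ℝ} (hab : a ≤ b) (hcd : c ≤ d) :
    IsSteinerCoeff (box a b c d) ![1, (b - a) + (d - c), (b - a) * (d - c)] := by
  intro ε hε
  have h1 : 0 ≤ b - a := sub_nonneg.2 hab
  have h2 : 0 ≤ d - c := sub_nonneg.2 hcd
  rw [volume_cthickening_box hab hcd hε, volume_parallelBox_left hab hε,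
    volume_parallelBox_swap 0 0 c d, volume_parallelBox_left hcd hε,
    volume_parallelBox_zero hε, ← ENNReal.ofReal_mul h1, ← ENNReal.ofReal_mul h2,
    ← ENNReal.ofReal_add (by positivity) (by positivity),
    ← ENNReal.ofReal_add (by positivity) (by positivity), ENNReal.toReal_ofReal (by positivity)]
  rw [Fin.sum_univ_three]
  simp [kappa_zero, kappa_one, kappa_two]
  ring

lemma isSteinerCoeff_empty : IsSteinerCoeff (∅ : Set Plane) 0 := by
  intro ε _
  simp

lemma exists_isSteinerCoeff_box (a b c d : ℝ) : ∃ w, IsSteinerCoeff (box a b c d) w := by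
  by_cases h : a ≤ b ∧ c ≤ d
  · exact ⟨_, isSteinerCoeff_box h.1 h.2⟩
  · have : box a b c d = ∅ := by
      ext x
      simp only [box, Set.mem_ofPred_eq, Set.mem_empty_iff_false, iff_false]
      exact fun hx => h ⟨hx.1.1.trans hx.1.2, hx.2.1.trans hx.2.2⟩
    rw [this]
    exact ⟨_, isSteinerCoeff_empty⟩

lemma box_inter_box (a b c d a' b' c' d' : ℝ) :
    box a b c d ∩ box a' b' c' d' = box (max a a') (min b b') (max c c') (min d d') := by
  ext x
  simp only [box, Set.mem_inter_iff, Set.mem_ofPred_eq, Set.mem_Icc, max_le_iff, le_min_iff]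
  tauto

/-- Finite unions of boxes have intrinsic volumes. -/
lemma exists_hasIntrinsicVolumes {m : ℕ} (C : Fin m → Set Plane)
    (hC : ∀ i, ∃ a b c d, C i = box a b c d) : ∃ v, HasIntrinsicVolumes (⋃ i, C i) v := by
  have hinter : ∀ t : Finset (Fin m), t.Nonempty → ∃ a b c d, ⋂ i ∈ t, C i = box a b c d := by
    intro t ht
    induction ht using Finset.Nonempty.cons_induction with
    | singleton i => simpa using hC i
    | cons i t hi ht ih =>
      obtain ⟨a, b, c, d, h⟩ := ih
      obtain ⟨a', b', c', d', h'⟩ := hC i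
      simp only [Finset.mem_cons, Set.iInter_iInter_eq_or_left, h, h', box_inter_box]
      exact ⟨_, _, _, _, rfl⟩
  -- For empty `t` the intersection is the whole plane; the value `0` chosen there is never used.
  have hex : ∀ t : Finset (Fin m), ∃ w : Fin 3 → ℝ, t.Nonempty → IsSteinerCoeff (⋂ i ∈ t, C i) w := by
    intro t
    by_cases ht : t.Nonempty
    · obtain ⟨a, b, c, d, h⟩ := hinter t ht
      rw [h]
      exact (exists_isSteinerCoeff_box a b c d).imp fun _ hw _ => hw
    · exact ⟨0, fun h => absurd h ht⟩
  choose w hw using hex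
  refine ⟨_, m, C, w, fun i => ?_, rfl, hw, fun k => rfl⟩
  obtain ⟨a, b, c, d, h⟩ := hC i
  rw [h]
  exact ⟨isCompact_box a b c d, convex_box a b c d⟩

/-! ### Words and grid squares -/

section Words

variable {M : ℕ}

/-- The grid square with indices `i, j` in the grid of mesh size `1 / N`. -/
def gridSquare (N : ℝ) (i j : ℕ) : Set Plane := box (i / N) ((i + 1) / N) (j / N) ((j + 1) / N)

/-- The indices of the grid square of the previous level that contains the square `q`. -/
def parent (M : ℕ) (q : ℕ × ℕ) : ℕ × ℕ := (q.1 / M, q.2 / M)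

/-- The `k`-th index of the grid square encoded by a word. -/
def wordIndex (k : Fin 2) (σ : List (Letter 2 M)) : ℕ :=
  Nat.ofDigits M (σ.map fun a => (a k : ℕ)).reverse

/-- The last letter is the lowest digit in base `M`. Both this form and `wordIndex_cons` are needed:
`tree` grows words at the end, `cube` is defined by recursion on the head. -/
lemma wordIndex_concat (k : Fin 2) (σ : List (Letter 2 M)) (a : Letter 2 M) :
    wordIndex k (σ ++ [a]) = (a k : ℕ) + M * wordIndex k σ := by
  simp [wordIndex, Nat.ofDigits_cons]

lemma wordIndex_cons (k : Fin 2) (a : Letter 2 M) (σ : List (Letter 2 M)) :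
    wordIndex k (a :: σ) = wordIndex k σ + M ^ σ.length * (a k : ℕ) := by
  simp [wordIndex, Nat.ofDigits_append]

lemma parent_lt {n : ℕ} {q : ℕ × ℕ} (h : q.1 < M ^ (n + 1) ∧ q.2 < M ^ (n + 1)) :
    (parent M q).1 < M ^ n ∧ (parent M q).2 < M ^ n := by
  simp only [pow_succ] at h
  exact ⟨Nat.div_lt_of_lt_mul (by linarith), Nat.div_lt_of_lt_mul (by linarith)⟩

lemma wordIndex_lt (k : Fin 2) (σ : List (Letter 2 M)) : wordIndex k σ < M ^ σ.length := by
  induction σ with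
  | nil => simp [wordIndex]
  | cons a σ ih =>
    rw [wordIndex_cons, List.length_cons, pow_succ]
    have h : (a k : ℕ) + 1 ≤ M := (a k).2
    have := Nat.mul_le_mul_left (M ^ σ.length) h
    linarith

variable [NeZero M]

/-- The position of the grid square `q` in its parent square. -/
def letter (M : ℕ) [NeZero M] (q : ℕ × ℕ) : Letter 2 M := ![Fin.ofNat M q.1, Fin.ofNat M q.2]

/-- The word of length `n` that encodes the grid square `q` of level `n`. -/
def word (M : ℕ) [NeZero M] : ℕ → ℕ × ℕ → List (Letter 2 M)
  | 0, _ => []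
  | n + 1, q => word M n (parent M q) ++ [letter M q]

lemma length_word (n : ℕ) (q : ℕ × ℕ) : (word M n q).length = n := by
  induction n generalizing q with
  | zero => rfl
  | succ n ih => simp [word, ih]

lemma wordIndex_word {n : ℕ} {q : ℕ × ℕ} (h : q.1 < M ^ n ∧ q.2 < M ^ n) :
    (wordIndex 0 (word M n q), wordIndex 1 (word M n q)) = q := by
  induction n generalizing q with
  | zero =>
    simp only [pow_zero, Nat.lt_one_iff] at h
    exact Prod.ext h.1.symm h.2.symm
  | succ n ih =>
    obtain ⟨h0, h1⟩ := Prod.ext_iff.1 (ih (parent_lt h))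
    dsimp only at h0 h1
    simp only [word, wordIndex_concat, h0, h1]
    refine Prod.ext ?_ ?_ <;> simp [letter, parent, Nat.mod_add_div]

lemma word_injOn {n : ℕ} {q r : ℕ × ℕ} (hq : q.1 < M ^ n ∧ q.2 < M ^ n)
    (hr : r.1 < M ^ n ∧ r.2 < M ^ n) (h : word M n q = word M n r) : q = r := by
  rw [← wordIndex_word hq, ← wordIndex_word hr, h]

lemma word_wordIndex (σ : List (Letter 2 M)) :
    word M σ.length (wordIndex 0 σ, wordIndex 1 σ) = σ := by
  induction σ using List.reverseRecOn with
  | nil => rfl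
  | append_singleton σ a ih =>
    have hM : 0 < M := NeZero.pos M
    have hdiv : ∀ k, ((a k : ℕ) + M * wordIndex k σ) / M = wordIndex k σ := fun k => by
      rw [Nat.add_mul_div_left _ _ hM, Nat.div_eq_of_lt (a k).2, zero_add]
    rw [List.length_append, List.length_singleton, word]
    simp only [parent, wordIndex_concat, hdiv, ih]
    congr 2
    ext k
    fin_cases k <;> simp [letter, Nat.mod_eq_of_lt]

lemma phi_image_box (a : Letter 2 M) (s t u v : ℝ) :
    phi a '' box s t u v = box ((s + (a 0 : ℕ)) / M) ((t + (a 0 : ℕ)) / M)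
      ((u + (a 1 : ℕ)) / M) ((v + (a 1 : ℕ)) / M) := by
  have hM : (0 : ℝ) < M := Nat.cast_pos.2 (NeZero.pos M)
  ext x
  simp only [box, Set.mem_image, Set.mem_ofPred_eq, Set.mem_Icc, div_le_iff₀ hM, le_div_iff₀ hM]
  constructor
  · rintro ⟨y, ⟨⟨h1, h2⟩, h3, h4⟩, rfl⟩
    simp only [phi, div_mul_cancel₀ _ hM.ne', add_le_add_iff_right]
    exact ⟨⟨h1, h2⟩, h3, h4⟩
  · rintro ⟨⟨h1, h2⟩, h3, h4⟩
    refine ⟨!₂[x 0 * M - (a 0 : ℕ), x 1 * M - (a 1 : ℕ)], ⟨⟨?_, ?_⟩, ?_, ?_⟩, ?_⟩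
    · simpa [le_sub_iff_add_le] using h1
    · simpa [sub_le_iff_le_add] using h2
    · simpa [le_sub_iff_add_le] using h3
    · simpa [sub_le_iff_le_add] using h4
    · ext k
      fin_cases k <;> simp [phi, hM.ne']

lemma cube_eq_gridSquare (σ : List (Letter 2 M)) :
    cube σ = gridSquare ((M : ℝ) ^ σ.length) (wordIndex 0 σ) (wordIndex 1 σ) := by
  have hM : (M : ℝ) ≠ 0 := Nat.cast_ne_zero.2 (NeZero.ne M)
  induction σ with
  | nil =>
    ext x
    simp [cube, unitCube, gridSquare, box, wordIndex, Fin.forall_fin_two]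
  | cons a σ ih =>
    rw [cube, ih, gridSquare, phi_image_box, gridSquare, List.length_cons]
    simp only [wordIndex_cons]
    push_cast
    congr 1 <;> field_simp <;> ring

end Words

/-! ### Surviving squares -/

section Survival

variable {Ω : Type*} {M : ℕ} (keep : List (Letter 2 M) → Letter 2 M → Set Ω)

lemma length_of_mem_tree {ω : Ω} {n : ℕ} {σ : List (Letter 2 M)} (h : σ ∈ tree keep ω n) :
    σ.length = n := by
  induction n generalizing σ with
  | zero => rw [Set.mem_singleton_iff.1 h]; rfl
  | succ n ih =>
    obtain ⟨τ, hτ, a, -, rfl⟩ := h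
    simp [ih hτ]

variable [NeZero M]

/-- The event that the grid square `q` of level `n` survives. -/
def surv (n : ℕ) (q : ℕ × ℕ) : Set Ω := {ω | word M n q ∈ tree keep ω n}

lemma surv_zero (q : ℕ × ℕ) : surv keep 0 q = Set.univ := by
  ext ω
  simp [surv, word, tree]

lemma surv_succ (n : ℕ) (q : ℕ × ℕ) : surv keep (n + 1) q =
    surv keep n (parent M q) ∩ keep (word M n (parent M q)) (letter M q) := by
  ext ω
  simp only [surv, word, tree, Set.mem_ofPred_eq, Set.mem_inter_iff]
  constructor
  · rintro ⟨σ, hσ, a, ha, h⟩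
    obtain ⟨rfl, h2⟩ := List.append_inj' h rfl
    obtain rfl := (List.singleton_inj.1 h2)
    exact ⟨hσ, ha⟩
  · rintro ⟨h1, h2⟩
    exact ⟨_, h1, _, h2, rfl⟩

lemma mem_step_iff (n : ℕ) (ω : Ω) (x : Plane) : x ∈ step keep n ω ↔
    ∃ i < M ^ n, ∃ j < M ^ n, ω ∈ surv keep n (i, j) ∧ x ∈ gridSquare ((M : ℝ) ^ n) i j := by
  simp only [step, Set.mem_iUnion, exists_prop]
  constructor
  · rintro ⟨σ, hσ, hx⟩
    obtain rfl := length_of_mem_tree keep hσ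
    refine ⟨_, wordIndex_lt 0 σ, _, wordIndex_lt 1 σ, ?_, cube_eq_gridSquare σ ▸ hx⟩
    rw [surv, Set.mem_ofPred_eq, word_wordIndex]
    exact hσ
  · rintro ⟨i, hi, j, hj, hω, hx⟩
    refine ⟨_, hω, ?_⟩
    obtain ⟨h0, h1⟩ := Prod.ext_iff.1 (wordIndex_word (M := M) (q := (i, j)) ⟨hi, hj⟩)
    dsimp only at h0 h1
    rw [cube_eq_gridSquare, length_word, h0, h1]
    exact hx

lemma exists_hasIntrinsicVolumes_step (n : ℕ) (ω : Ω) :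
    ∃ v, HasIntrinsicVolumes (step keep n ω) v := by
  classical
  -- Squares that do not survive are replaced by `box 1 0 1 0`, an empty box, so that the index type
  -- does not depend on `ω`.
  let C : Fin (M ^ n * M ^ n) → Set Plane := fun k =>
    if ω ∈ surv keep n ((finProdFinEquiv.symm k).1, (finProdFinEquiv.symm k).2) then
      gridSquare ((M : ℝ) ^ n) (finProdFinEquiv.symm k).1 (finProdFinEquiv.symm k).2
    else box 1 0 1 0
  have hempty : box 1 0 1 0 = ∅ := by
    ext x
    simp [box]
  have h : step keep n ω = ⋃ k, C k := by
    ext x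
    rw [mem_step_iff, Set.mem_iUnion]
    constructor
    · rintro ⟨i, hi, j, hj, hω, hx⟩
      refine ⟨finProdFinEquiv (⟨i, hi⟩, ⟨j, hj⟩), ?_⟩
      simp only [C, Equiv.symm_apply_apply, if_pos hω]
      exact hx
    · rintro ⟨k, hk⟩
      simp only [C] at hk
      split_ifs at hk with hω
      · exact ⟨_, Fin.is_lt _, _, Fin.is_lt _, hω, hk⟩
      · rw [hempty] at hk
        exact absurd hk (Set.notMem_empty x)
  rw [h]
  refine exists_hasIntrinsicVolumes C fun k => ?_
  simp only [C]
  split_ifs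
  · exact ⟨_, _, _, _, rfl⟩
  · exact ⟨_, _, _, _, rfl⟩

/-- The branchings on which the survival of the grid squares in `S` depends. -/
def branchings (M : ℕ) [NeZero M] :
    ℕ → Finset (ℕ × ℕ) → Finset (List (Letter 2 M) × Letter 2 M)
  | 0, _ => ∅
  | n + 1, S => branchings M n (S.image (parent M)) ∪
      S.image fun q => (word M n (parent M q), letter M q)

/-- The probability that all the grid squares in `S` of level `n` survive. -/
noncomputable def survProb (M : ℕ) (p : ℝ) : ℕ → Finset (ℕ × ℕ) → ℝ
  | 0, _ => 1
  | n + 1, S => p ^ S.card * survProb M p n (S.image (parent M))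

/-- Rewrites a joint survival event through the independent events `keep`. As `branchings` is a
finset, common ancestors are counted once. -/
lemma biInter_surv (n : ℕ) (S : Finset (ℕ × ℕ)) :
    ⋂ q ∈ S, surv keep n q = ⋂ b ∈ branchings M n S, keep b.1 b.2 := by
  induction n generalizing S with
  | zero => simp [branchings, surv_zero]
  | succ n ih =>
    rw [branchings, Finset.set_biInter_inter, ← ih, Finset.set_biInter_finset_image,
      Finset.set_biInter_finset_image]
    simp_rw [surv_succ, Set.iInter_inter_distrib]

lemma length_of_mem_branchings {n : ℕ} {S : Finset (ℕ × ℕ)} {b : List (Letter 2 M) × Letter 2 M}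
    (h : b ∈ branchings M n S) : b.1.length < n := by
  induction n generalizing S with
  | zero => simp [branchings] at h
  | succ n ih =>
    rw [branchings, Finset.mem_union, Finset.mem_image] at h
    rcases h with h | ⟨q, -, rfl⟩
    · exact (ih h).trans n.lt_succ_self
    · simp [length_word]

/-- Branchings of different levels differ in word length, and within a level distinct squares of the
grid give distinct branchings; so the cardinality satisfies the recursion of the exponent in
`survProb`. -/
lemma pow_card_branchings (p : ℝ) (n : ℕ) (S : Finset (ℕ × ℕ))
    (hS : ∀ q ∈ S, q.1 < M ^ n ∧ q.2 < M ^ n) :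
    p ^ (branchings M n S).card = survProb M p n S := by
  induction n generalizing S with
  | zero => simp [branchings, survProb]
  | succ n ih =>
    rw [branchings, Finset.card_union_of_disjoint, pow_add, ih, Finset.card_image_of_injOn,
      survProb, mul_comm]
    · intro q hq r hr h
      refine word_injOn (hS q hq) (hS r hr) ?_
      simp only [Prod.mk.injEq] at h
      rw [word, word, h.1, h.2]
    · intro q hq
      obtain ⟨r, hr, rfl⟩ := Finset.mem_image.1 hq
      exact parent_lt (hS r hr)
    · rw [Finset.disjoint_left]
      intro b hb hb'
      obtain ⟨q, -, rfl⟩ := Finset.mem_image.1 hb'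
      have := length_of_mem_branchings hb
      simp [length_word] at this

variable {keep} [MeasurableSpace Ω] {P : Measure Ω} {p : ℝ}

lemma IsPercolation.measurableSet_biInter_surv (hk : IsPercolation P p keep) (n : ℕ)
    (S : Finset (ℕ × ℕ)) : MeasurableSet (⋂ q ∈ S, surv keep n q) := by
  rw [biInter_surv]
  exact Finset.measurableSet_biInter _ fun b _ => hk.measurableSet _ _

lemma IsPercolation.measureReal_biInter_surv (hk : IsPercolation P p keep) (hp : 0 ≤ p) (n : ℕ)
    (S : Finset (ℕ × ℕ)) (hS : ∀ q ∈ S, q.1 < M ^ n ∧ q.2 < M ^ n) :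
    P.real (⋂ q ∈ S, surv keep n q) = survProb M p n S := by
  rw [biInter_surv, Measure.real,
    hk.indep.meas_biInter (f := fun b : List (Letter 2 M) × Letter 2 M => keep b.1 b.2)]
  simp_rw [hk.prob]
  rw [Finset.prod_const, ENNReal.toReal_pow, ENNReal.toReal_ofReal hp, pow_card_branchings p n S hS]

end Survival

/-! ### Inclusion-exclusion on the grid -/

lemma ind_and (q r : Prop) : ind (q ∧ r) = ind q * ind r := by
  by_cases hq : q <;> by_cases hr : r <;> simp [ind, hq, hr]

lemma ind_nonneg (q : Prop) : 0 ≤ ind q := by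
  by_cases hq : q <;> simp [ind, hq]

lemma ind_eq_zero_or_one (q : Prop) : ind q = 0 ∨ ind q = 1 := by
  by_cases hq : q <;> simp [ind, hq]

/-- A real number lies in none, in one, or in two consecutive ones of the intervals `[i, i + 1]`
with `i < N`. -/
lemma exists_sum_ind_unitInterval_eq (N : ℕ) (y : ℝ) : ∃ (k : ℕ) (a b : ℝ),
    (a = 0 ∧ b = 0 ∨ a = 1 ∧ b = 0 ∨ a = 1 ∧ b = 1) ∧
    (∀ f : ℕ → ℝ, ∑ i ∈ Finset.range N, ind ((i : ℝ) ≤ y ∧ y ≤ i + 1) * f i =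
      a * f k + b * f (k + 1)) ∧
    ∀ g : ℕ → ℝ, ∑ i ∈ Finset.range (N - 1), ind (y = i + 1) * g i = b * g k := by
  by_cases h1 : ∃ k : ℕ, k + 1 < N ∧ y = k + 1
  -- An interior grid point lies in two intervals. The ends `0` and `N` fall under the later case of
  -- a single interval.
  · obtain ⟨k, hk, rfl⟩ := h1
    refine ⟨k, 1, 1, Or.inr (Or.inr ⟨rfl, rfl⟩), fun f => ?_, fun g => ?_⟩
    · have : ∀ i : ℕ, ind ((i : ℝ) ≤ (k : ℝ) + 1 ∧ (k : ℝ) + 1 ≤ i + 1) * f i =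
          (if i = k then f i else 0) + if i = k + 1 then f i else 0 := by
        intro i
        have : ((i : ℝ) ≤ (k : ℝ) + 1 ∧ (k : ℝ) + 1 ≤ i + 1) ↔ i = k ∨ i = k + 1 := by
          norm_cast
          omega
        rw [this]
        by_cases h : i = k <;> by_cases h' : i = k + 1 <;> simp [ind, h, h']
      simp_rw [this]
      rw [Finset.sum_add_distrib, Finset.sum_ite_eq', Finset.sum_ite_eq']
      simp [hk, Nat.lt_of_succ_lt hk]
    · have : ∀ i : ℕ, ind ((k : ℝ) + 1 = i + 1) * g i = if i = k then g i else 0 := by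
        intro i
        by_cases h : i = k
        · simp [ind, h]
        · have : (k : ℝ) ≠ i := fun h' => h (by exact_mod_cast h'.symm)
          simp [ind, h, this]
      simp_rw [this]
      rw [Finset.sum_ite_eq', if_pos (by simp; omega), one_mul]
  have hz : ∀ g : ℕ → ℝ, ∑ i ∈ Finset.range (N - 1), ind (y = i + 1) * g i = 0 := by
    intro g
    refine Finset.sum_eq_zero fun i hi => ?_
    rw [ind_false, zero_mul]
    exact fun h => h1 ⟨i, by have := Finset.mem_range.1 hi; omega, h⟩
  by_cases h2 : ∃ k : ℕ, k < N ∧ (k : ℝ) ≤ y ∧ y ≤ k + 1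
  · obtain ⟨k, hk, hy1, hy2⟩ := h2
    refine ⟨k, 1, 0, Or.inr (Or.inl ⟨rfl, rfl⟩), fun f => ?_, fun g => by rw [hz, zero_mul]⟩
    rw [Finset.sum_eq_single k]
    · rw [ind_true ⟨hy1, hy2⟩]
      ring
    · intro i hi hik
      rw [ind_false, zero_mul]
      -- Two distinct unit intervals share a point only at an interior grid point, which `h1`
      -- excludes.
      rintro ⟨h3, h4⟩
      have hi := Finset.mem_range.1 hi
      rcases lt_or_gt_of_ne hik with h | h
      · have : (i : ℝ) + 1 ≤ k := by exact_mod_cast h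
        exact h1 ⟨i, by omega, by linarith⟩
      · have : (k : ℝ) + 1 ≤ i := by exact_mod_cast h
        exact h1 ⟨k, by omega, by linarith⟩
    · intro h
      exact absurd (Finset.mem_range.2 hk) h
  · refine ⟨0, 0, 0, Or.inl ⟨rfl, rfl⟩, fun f => ?_, fun g => by rw [hz, zero_mul]⟩
    rw [zero_mul, zero_mul, add_zero]
    refine Finset.sum_eq_zero fun i hi => ?_
    rw [ind_false, zero_mul]
    exact fun h => h2 ⟨i, Finset.mem_range.1 hi, h⟩

/-- The subsets of the four squares around a vertex whose projections to both axes are full. -/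
def vertexPattern : Fin 7 → Finset (ℕ × ℕ) :=
  ![{(0, 0), (1, 1)}, {(1, 0), (0, 1)}, {(0, 0), (1, 0), (0, 1)}, {(0, 0), (1, 0), (1, 1)},
    {(0, 0), (0, 1), (1, 1)}, {(1, 0), (0, 1), (1, 1)}, {(0, 0), (1, 0), (0, 1), (1, 1)}]

/-- The translate of a finite set of grid squares by `(i, j)`. -/
def translate (T : Finset (ℕ × ℕ)) (i j : ℕ) : Finset (ℕ × ℕ) :=
  T.image fun t => (i + t.1, j + t.2)

/-- The inclusion-exclusion coefficient of the vertex between the squares `(i, j)` and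
`(i + 1, j + 1)`. -/
noncomputable def vertexCoeff (f : Finset (ℕ × ℕ) → ℝ) (i j : ℕ) : ℝ :=
  ∑ t, (-1) ^ ((vertexPattern t).card + 1) * f (translate (vertexPattern t) i j)

/-- The sum of `f` over the squares of the `N × N` grid. -/
noncomputable def squareSum (N : ℕ) (f : Finset (ℕ × ℕ) → ℝ) : ℝ :=
  ∑ i ∈ Finset.range N, ∑ j ∈ Finset.range N, f {(i, j)}

/-- The sum of `f` over the pairs of squares that are neighbours in the first direction. -/
noncomputable def horizontalSum (N : ℕ) (f : Finset (ℕ × ℕ) → ℝ) : ℝ :=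
  ∑ i ∈ Finset.range (N - 1), ∑ j ∈ Finset.range N, f {(i, j), (i + 1, j)}

/-- The sum of `f` over the pairs of squares that are neighbours in the second direction. -/
noncomputable def verticalSum (N : ℕ) (f : Finset (ℕ × ℕ) → ℝ) : ℝ :=
  ∑ i ∈ Finset.range N, ∑ j ∈ Finset.range (N - 1), f {(i, j), (i, j + 1)}

/-- The sum of `f` over the translates of `T` along the inner vertices of the grid. -/
noncomputable def vertexSum (N : ℕ) (T : Finset (ℕ × ℕ)) (f : Finset (ℕ × ℕ) → ℝ) : ℝ :=
  ∑ i ∈ Finset.range (N - 1), ∑ j ∈ Finset.range (N - 1), f (translate T i j)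

lemma vertexCoeff_eq (f : Finset (ℕ × ℕ) → ℝ) (i j : ℕ) : vertexCoeff f i j =
    -f {(i, j), (i + 1, j + 1)} - f {(i + 1, j), (i, j + 1)}
      + f {(i, j), (i + 1, j), (i, j + 1)} + f {(i, j), (i + 1, j), (i + 1, j + 1)}
      + f {(i, j), (i, j + 1), (i + 1, j + 1)} + f {(i + 1, j), (i, j + 1), (i + 1, j + 1)}
      - f {(i, j), (i + 1, j), (i, j + 1), (i + 1, j + 1)} := by
  have h : ∀ t, (vertexPattern t).card = ![2, 2, 3, 3, 3, 3, 4] t := by decide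
  simp only [vertexCoeff, h, Fin.sum_univ_seven]
  simp [vertexPattern, translate, Finset.image_insert, pow_succ]
  ring

/-- Puts the existential into the form of a double sum of indicators, to which the evaluation by
`exists_sum_ind_unitInterval_eq` applies. -/
lemma ind_exists_lt_eq (N : ℕ) (Y : ℕ → ℕ → Prop) :
    ind (∃ i < N, ∃ j < N, Y i j) =
      ind (∑ i ∈ Finset.range N, ∑ j ∈ Finset.range N, ind (Y i j) ≠ 0) := by
  congr 1
  apply propext
  rw [← not_iff_not, not_not, Finset.sum_eq_zero_iff_of_nonneg fun i _ =>
    Finset.sum_nonneg fun j _ => ind_nonneg _]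
  simp_rw [Finset.sum_eq_zero_iff_of_nonneg fun _ _ => ind_nonneg _]
  constructor
  · intro h i hi j hj
    exact ind_false fun hY => h ⟨i, Finset.mem_range.1 hi, j, Finset.mem_range.1 hj, hY⟩
  · rintro h ⟨i, hi, j, hj, hY⟩
    have := h i (Finset.mem_range.2 hi) j (Finset.mem_range.2 hj)
    rw [ind_true hY] at this
    exact one_ne_zero this

/-- The indicator of the event that all squares in `S` satisfy `X`. -/
noncomputable def allInd (X : ℕ × ℕ → Prop) (S : Finset (ℕ × ℕ)) : ℝ := ind (∀ q ∈ S, X q)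

lemma allInd_insert (X : ℕ × ℕ → Prop) (q : ℕ × ℕ) (S : Finset (ℕ × ℕ)) :
    allInd X (insert q S) = ind (X q) * allInd X S := by
  rw [allInd, Finset.forall_mem_insert, ind_and, allInd]

lemma allInd_singleton (X : ℕ × ℕ → Prop) (q : ℕ × ℕ) : allInd X {q} = ind (X q) := by
  simp [allInd]

lemma mem_box_div_iff {N : ℝ} (hN : 0 < N) (s t u v : ℝ) (x : Plane) :
    x ∈ box (s / N) (t / N) (u / N) (v / N) ↔
      (s ≤ x 0 * N ∧ x 0 * N ≤ t) ∧ (u ≤ x 1 * N ∧ x 1 * N ≤ v) := by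
  simp only [box, Set.mem_ofPred_eq, Set.mem_Icc, div_le_iff₀ hN, le_div_iff₀ hN]

/-- The indicator of a union of grid squares as a combination of indicators of squares, edges and
vertices of the grid. -/
lemma ind_union_gridSquare {N : ℕ} (hN : 0 < N) (X : ℕ × ℕ → Prop) (x : Plane) :
    ind (∃ i < N, ∃ j < N, X (i, j) ∧ x ∈ gridSquare N i j) =
      ∑ i ∈ Finset.range N, ∑ j ∈ Finset.range N,
        allInd X {(i, j)} * ind (x ∈ gridSquare N i j)
      - ∑ i ∈ Finset.range (N - 1), ∑ j ∈ Finset.range N, allInd X {(i, j), (i + 1, j)} *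
        ind (x ∈ box ((i + 1) / N) ((i + 1) / N) (j / N) ((j + 1) / N))
      - ∑ i ∈ Finset.range N, ∑ j ∈ Finset.range (N - 1), allInd X {(i, j), (i, j + 1)} *
        ind (x ∈ box (i / N) ((i + 1) / N) ((j + 1) / N) ((j + 1) / N))
      + ∑ i ∈ Finset.range (N - 1), ∑ j ∈ Finset.range (N - 1), vertexCoeff (allInd X) i j *
        ind (x ∈ box ((i + 1) / N) ((i + 1) / N) ((j + 1) / N) ((j + 1) / N)) := by
  have hN' : (0 : ℝ) < N := Nat.cast_pos.2 hN
  have hc : ∀ (s t : Finset ℕ) (c : ℕ → ℕ → ℝ) (A B : ℕ → Prop),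
      ∑ i ∈ s, ∑ j ∈ t, c i j * ind (A i ∧ B j) =
        ∑ i ∈ s, ind (A i) * ∑ j ∈ t, ind (B j) * c i j := by
    intro s t c A B
    simp_rw [Finset.mul_sum, ind_and]
    exact Finset.sum_congr rfl fun i _ => Finset.sum_congr rfl fun j _ => by ring
  have heq : ∀ s t : ℝ, (s ≤ t ∧ t ≤ s) ↔ t = s := fun s t =>
    ⟨fun h => le_antisymm h.2 h.1, fun h => ⟨h.ge, h.le⟩⟩
  rw [ind_exists_lt_eq]
  simp only [gridSquare, mem_box_div_iff hN', heq, ind_and (X _), hc]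
  -- Only the four squares with indices `k, k + 1` and `l, l + 1` can contain `x`. Both sides become
  -- expressions in four presence indicators and the weights `a, b, c, d`, leaving finitely many
  -- cases.
  obtain ⟨k, a, b, hab, hf, hg⟩ := exists_sum_ind_unitInterval_eq N (x 0 * N)
  obtain ⟨l, c, d, hcd, hf', hg'⟩ := exists_sum_ind_unitInterval_eq N (x 1 * N)
  simp only [hf, hg, hf', hg', vertexCoeff_eq, allInd_insert, allInd_singleton]
  generalize X (k, l) = q1
  generalize X (k + 1, l) = q2
  generalize X (k, l + 1) = q3
  generalize X (k + 1, l + 1) = q4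
  clear hf hg hf' hg' hc heq
  rcases ind_eq_zero_or_one q1 with h1 | h1 <;>
  rcases ind_eq_zero_or_one q2 with h2 | h2 <;>
  rcases ind_eq_zero_or_one q3 with h3 | h3 <;>
  rcases ind_eq_zero_or_one q4 with h4 | h4 <;>
  rw [h1, h2, h3, h4] <;>
  rcases hab with ⟨rfl, rfl⟩ | ⟨rfl, rfl⟩ | ⟨rfl, rfl⟩ <;>
  rcases hcd with ⟨rfl, rfl⟩ | ⟨rfl, rfl⟩ | ⟨rfl, rfl⟩ <;>
  norm_num [ind]

/-! ### Intrinsic volumes of unions of grid squares -/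

lemma box_mem_valuationGraph {a b c d : ℝ} (hab : a ≤ b) (hcd : c ≤ d) :
    ((fun x => ind (x ∈ box a b c d)), ![1, (b - a) + (d - c), (b - a) * (d - c)]) ∈
      valuationGraph :=
  mem_valuationGraph (isCompact_box a b c d) (convex_box a b c d) (isSteinerCoeff_box hab hcd)

lemma sum_smul_mem_valuationGraph (s t : Finset ℕ) (c : ℕ → ℕ → ℝ) (B : ℕ → ℕ → Set Plane)
    (w : Fin 3 → ℝ) (h : ∀ i j, ((fun x => ind (x ∈ B i j)), w) ∈ valuationGraph) :
    ((fun x => ∑ i ∈ s, ∑ j ∈ t, c i j * ind (x ∈ B i j)), (∑ i ∈ s, ∑ j ∈ t, c i j) • w) ∈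
      valuationGraph := by
  have : ((fun x => ∑ i ∈ s, ∑ j ∈ t, c i j * ind (x ∈ B i j)), (∑ i ∈ s, ∑ j ∈ t, c i j) • w) =
      ∑ i ∈ s, ∑ j ∈ t, c i j • ((fun x => ind (x ∈ B i j)), w) := by
    refine Prod.ext ?_ ?_
    · ext x
      simp [Prod.fst_sum, Finset.sum_apply]
    · simp [Prod.snd_sum, Finset.sum_smul]
  rw [this]
  exact Submodule.sum_mem _ fun i _ => Submodule.sum_mem _ fun j _ =>
    Submodule.smul_mem _ _ (h i j)

/-- The intrinsic volumes of a union of squares of the `N × N` grid, in terms of the values `f S`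
of the indicators of the presence of all squares in `S`. -/
noncomputable def gridVolume (N : ℕ) (f : Finset (ℕ × ℕ) → ℝ) : Fin 3 → ℝ :=
  squareSum N f • (![1, 2 / N, 1 / N ^ 2] : Fin 3 → ℝ) -
    horizontalSum N f • (![1, 1 / N, 0] : Fin 3 → ℝ) -
    verticalSum N f • (![1, 1 / N, 0] : Fin 3 → ℝ) +
    (∑ t, (-1) ^ ((vertexPattern t).card + 1) * vertexSum N (vertexPattern t) f) •
      (![1, 0, 0] : Fin 3 → ℝ)

lemma sum_vertexCoeff (N : ℕ) (f : Finset (ℕ × ℕ) → ℝ) :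
    ∑ i ∈ Finset.range (N - 1), ∑ j ∈ Finset.range (N - 1), vertexCoeff f i j =
      ∑ t, (-1) ^ ((vertexPattern t).card + 1) * vertexSum N (vertexPattern t) f := by
  simp_rw [vertexCoeff, vertexSum, Finset.mul_sum]
  rw [Finset.sum_comm]
  simp_rw [Finset.sum_comm (s := Finset.range (N - 1)) (t := (Finset.univ : Finset (Fin 7)))]
  refine Finset.sum_congr rfl fun t _ => Finset.sum_comm

/-- The indicator identity lifts to `valuationGraph`, with Steiner coefficients `(1, 2/N, 1/N²)` for
a square, `(1, 1/N, 0)` for an edge and `(1, 0, 0)` for a vertex. -/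
lemma intrinsicVolume_union_gridSquare {N : ℕ} (hN : 0 < N) (X : ℕ × ℕ → Prop) {K : Set Plane}
    (hK : ∀ x, x ∈ K ↔ ∃ i < N, ∃ j < N, X (i, j) ∧ x ∈ gridSquare N i j)
    (hex : ∃ v, HasIntrinsicVolumes K v) (k : Fin 3) :
    intrinsicVolume k K = gridVolume N (allInd X) k := by
  have hN' : (0 : ℝ) < N := Nat.cast_pos.2 hN
  have hle : ∀ i : ℕ, (i : ℝ) / N ≤ (i + 1) / N := fun i => by gcongr; linarith
  have hdiff : ∀ i : ℕ, ((i : ℝ) + 1) / N - i / N = 1 / N := fun i => by ring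
  refine intrinsicVolume_eq hex ?_ k
  simp_rw [hK, ind_union_gridSquare hN X]
  have w1 : ∀ i j : ℕ, ((fun x => ind (x ∈ gridSquare N i j)),
      (![1, 2 / N, 1 / N ^ 2] : Fin 3 → ℝ)) ∈ valuationGraph := fun i j => by
    convert box_mem_valuationGraph (hle i) (hle j) using 2
    · rfl
    rw [hdiff, hdiff]
    ext k
    fin_cases k <;> simp <;> ring
  have w2 : ∀ i j : ℕ, ((fun x => ind (x ∈ box ((i + 1) / N) ((i + 1) / N) (j / N) ((j + 1) / N))),
      (![1, 1 / N, 0] : Fin 3 → ℝ)) ∈ valuationGraph := fun i j => by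
    convert box_mem_valuationGraph (le_refl (((i : ℝ) + 1) / N)) (hle j) using 2
    rw [hdiff, sub_self]
    ext k
    fin_cases k <;> simp
  have w3 : ∀ i j : ℕ, ((fun x => ind (x ∈ box (i / N) ((i + 1) / N) ((j + 1) / N) ((j + 1) / N))),
      (![1, 1 / N, 0] : Fin 3 → ℝ)) ∈ valuationGraph := fun i j => by
    convert box_mem_valuationGraph (hle i) (le_refl (((j : ℝ) + 1) / N)) using 2
    rw [hdiff, sub_self]
    ext k
    fin_cases k <;> simp
  have w4 : ∀ i j : ℕ, ((fun x => ind (x ∈ box ((i + 1) / N) ((i + 1) / N)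
      ((j + 1) / N) ((j + 1) / N))), (![1, 0, 0] : Fin 3 → ℝ)) ∈ valuationGraph := fun i j => by
    convert box_mem_valuationGraph (le_refl (((i : ℝ) + 1) / N)) (le_refl (((j : ℝ) + 1) / N))
      using 2
    rw [sub_self, sub_self]
    ext k
    fin_cases k <;> simp
  have h1 := sum_smul_mem_valuationGraph (Finset.range N) (Finset.range N)
    (fun i j => allInd X {(i, j)}) _ _ w1
  have h2 := sum_smul_mem_valuationGraph (Finset.range (N - 1)) (Finset.range N)
    (fun i j => allInd X {(i, j), (i + 1, j)}) _ _ w2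
  have h3 := sum_smul_mem_valuationGraph (Finset.range N) (Finset.range (N - 1))
    (fun i j => allInd X {(i, j), (i, j + 1)}) _ _ w3
  have h4 := sum_smul_mem_valuationGraph (Finset.range (N - 1)) (Finset.range (N - 1))
    (vertexCoeff (allInd X)) _ _ w4
  rw [sum_vertexCoeff] at h4
  exact Submodule.add_mem _ (Submodule.sub_mem _ (Submodule.sub_mem _ h1 h2) h3) h4

/-! ### Expectations -/

section Expectation

variable {Ω : Type*} {M : ℕ} [NeZero M] {p : ℝ}
  {keep : List (Letter 2 M) → Letter 2 M → Set Ω}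

lemma intrinsicVolume_step (n : ℕ) (ω : Ω) (k : Fin 3) :
    intrinsicVolume k (step keep n ω) =
      gridVolume (M ^ n) (allInd fun q => ω ∈ surv keep n q) k := by
  refine intrinsicVolume_union_gridSquare (Nat.pow_pos (NeZero.pos M)) _ (fun x => ?_)
    (exists_hasIntrinsicVolumes_step keep n ω) k
  rw [mem_step_iff, Nat.cast_pow]

lemma allInd_surv_eq_indicator (n : ℕ) (S : Finset (ℕ × ℕ)) :
    (fun ω => allInd (fun q => ω ∈ surv keep n q) S) =
      (⋂ q ∈ S, surv keep n q).indicator fun _ => (1 : ℝ) := by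
  ext ω
  have h : ω ∈ ⋂ q ∈ S, surv keep n q ↔ ∀ q ∈ S, ω ∈ surv keep n q := Set.mem_iInter₂
  by_cases hω : ∀ q ∈ S, ω ∈ surv keep n q
  · rw [Set.indicator_of_mem (h.2 hω), allInd, ind_true hω]
  · rw [Set.indicator_of_notMem (fun h' => hω (h.1 h')), allInd, ind_false hω]

variable [MeasurableSpace Ω] {P : Measure Ω}

lemma IsPercolation.integrable_allInd [IsFiniteMeasure P] (hk : IsPercolation P p keep) (n : ℕ)
    (S : Finset (ℕ × ℕ)) : Integrable (fun ω => allInd (fun q => ω ∈ surv keep n q) S) P := by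
  rw [allInd_surv_eq_indicator]
  exact (integrable_const _).indicator (hk.measurableSet_biInter_surv n S)

lemma IsPercolation.integral_allInd (hk : IsPercolation P p keep) (hp : 0 ≤ p) (n : ℕ)
    (S : Finset (ℕ × ℕ)) (hS : ∀ q ∈ S, q.1 < M ^ n ∧ q.2 < M ^ n) :
    ∫ ω, allInd (fun q => ω ∈ surv keep n q) S ∂P = survProb M p n S := by
  rw [allInd_surv_eq_indicator, integral_indicator (hk.measurableSet_biInter_surv n S),
    ← hk.measureReal_biInter_surv hp n S hS]
  simp

lemma integrable_sum_sum (s t : Finset ℕ) (c : Ω → ℕ → ℕ → ℝ)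
    (h : ∀ i j, Integrable (fun ω => c ω i j) P) :
    Integrable (fun ω => ∑ i ∈ s, ∑ j ∈ t, c ω i j) P :=
  integrable_finsetSum _ fun i _ => integrable_finsetSum _ fun j _ => h i j

lemma integral_sum_sum (s t : Finset ℕ) (c : Ω → ℕ → ℕ → ℝ) (e : ℕ → ℕ → ℝ)
    (h : ∀ i j, Integrable (fun ω => c ω i j) P)
    (he : ∀ i ∈ s, ∀ j ∈ t, ∫ ω, c ω i j ∂P = e i j) :
    ∫ ω, ∑ i ∈ s, ∑ j ∈ t, c ω i j ∂P = ∑ i ∈ s, ∑ j ∈ t, e i j := by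
  rw [integral_finsetSum _ fun i _ => integrable_finsetSum _ fun j _ => h i j]
  refine Finset.sum_congr rfl fun i hi => ?_
  rw [integral_finsetSum _ fun j _ => h i j]
  exact Finset.sum_congr rfl fun j hj => he i hi j hj

lemma vertexPattern_subset (t : Fin 7) : ∀ q ∈ vertexPattern t, q.1 ≤ 1 ∧ q.2 ≤ 1 := by
  revert t
  decide

lemma IsPercolation.integrable_gridVolume [IsFiniteMeasure P] (hk : IsPercolation P p keep)
    (n : ℕ) (k : Fin 3) :
    Integrable (fun ω => gridVolume (M ^ n) (allInd fun q => ω ∈ surv keep n q) k) P := by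
  simp only [gridVolume, Pi.add_apply, Pi.sub_apply, Pi.smul_apply, smul_eq_mul]
  refine Integrable.add (Integrable.sub (Integrable.sub ?_ ?_) ?_) ?_ <;>
  refine Integrable.mul_const ?_ _
  · exact integrable_sum_sum _ _ _ fun i j => hk.integrable_allInd n _
  · exact integrable_sum_sum _ _ _ fun i j => hk.integrable_allInd n _
  · exact integrable_sum_sum _ _ _ fun i j => hk.integrable_allInd n _
  · exact integrable_finsetSum _ fun t _ => Integrable.const_mul
      (integrable_sum_sum _ _ _ fun i j => hk.integrable_allInd n _) _

/-- `gridVolume` is linear in `f` and evaluates it only on sets inside the grid, where the expected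
joint indicator is `survProb`. -/
lemma IsPercolation.integral_gridVolume [IsFiniteMeasure P] (hk : IsPercolation P p keep)
    (hp : 0 ≤ p) (n : ℕ) (k : Fin 3) :
    ∫ ω, gridVolume (M ^ n) (allInd fun q => ω ∈ surv keep n q) k ∂P =
      gridVolume (M ^ n) (survProb M p n) k := by
  have hint := fun S => hk.integrable_allInd (n := n) (S := S)
  have i1 : Integrable (fun ω => squareSum (M ^ n) (allInd fun q => ω ∈ surv keep n q)) P :=
    integrable_sum_sum _ _ _ fun i j => hint _
  have i2 : Integrable (fun ω => horizontalSum (M ^ n) (allInd fun q => ω ∈ surv keep n q)) P :=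
    integrable_sum_sum _ _ _ fun i j => hint _
  have i3 : Integrable (fun ω => verticalSum (M ^ n) (allInd fun q => ω ∈ surv keep n q)) P :=
    integrable_sum_sum _ _ _ fun i j => hint _
  have i4 : ∀ T, Integrable
      (fun ω => vertexSum (M ^ n) T (allInd fun q => ω ∈ surv keep n q)) P := fun T =>
    integrable_sum_sum _ _ _ fun i j => hint _
  have e1 : ∫ ω, squareSum (M ^ n) (allInd fun q => ω ∈ surv keep n q) ∂P =
      squareSum (M ^ n) (survProb M p n) := by
    refine integral_sum_sum _ _ _ _ (fun i j => hint _) fun i hi j hj =>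
      hk.integral_allInd hp n _ ?_
    simp only [Finset.mem_range, Finset.mem_singleton] at *
    rintro q rfl
    exact ⟨hi, hj⟩
  have e2 : ∫ ω, horizontalSum (M ^ n) (allInd fun q => ω ∈ surv keep n q) ∂P =
      horizontalSum (M ^ n) (survProb M p n) := by
    refine integral_sum_sum _ _ _ _ (fun i j => hint _) fun i hi j hj =>
      hk.integral_allInd hp n _ ?_
    simp only [Finset.mem_range, Finset.mem_insert, Finset.mem_singleton] at *
    rintro q (rfl | rfl) <;> constructor <;> simp only <;> omega
  have e3 : ∫ ω, verticalSum (M ^ n) (allInd fun q => ω ∈ surv keep n q) ∂P =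
      verticalSum (M ^ n) (survProb M p n) := by
    refine integral_sum_sum _ _ _ _ (fun i j => hint _) fun i hi j hj =>
      hk.integral_allInd hp n _ ?_
    simp only [Finset.mem_range, Finset.mem_insert, Finset.mem_singleton] at *
    rintro q (rfl | rfl) <;> constructor <;> simp only <;> omega
  have e4 : ∀ t, ∫ ω, vertexSum (M ^ n) (vertexPattern t)
      (allInd fun q => ω ∈ surv keep n q) ∂P =
      vertexSum (M ^ n) (vertexPattern t) (survProb M p n) := by
    intro t
    refine integral_sum_sum _ _ _ _ (fun i j => hint _) fun i hi j hj =>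
      hk.integral_allInd hp n _ ?_
    intro q hq
    obtain ⟨r, hr, rfl⟩ := Finset.mem_image.1 hq
    have := vertexPattern_subset t r hr
    simp only [Finset.mem_range] at *
    omega
  simp only [gridVolume, Pi.add_apply, Pi.sub_apply, Pi.smul_apply, smul_eq_mul]
  rw [integral_add, integral_sub, integral_sub, integral_mul_const, integral_mul_const,
    integral_mul_const, integral_mul_const, integral_finsetSum, e1, e2, e3]
  · simp_rw [integral_const_mul, e4]
  · exact fun t _ => (i4 _).const_mul _
  · exact i1.mul_const _
  · exact i2.mul_const _
  · exact (i1.mul_const _).sub (i2.mul_const _)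
  · exact i3.mul_const _
  · exact ((i1.mul_const _).sub (i2.mul_const _)).sub (i3.mul_const _)
  · exact (integrable_finsetSum _ fun t _ => (i4 _).const_mul _).mul_const _

end Expectation

/-! ### Recursions for the expected sums -/

lemma sum_range_mul_of_div {M : ℕ} (N : ℕ) (φ ψ : ℕ → ℝ)
    (h : ∀ q < N, ∀ r < M, φ (q * M + r) = ψ q) :
    ∑ i ∈ Finset.range (N * M), φ i = M * ∑ q ∈ Finset.range N, ψ q := by
  induction N with
  | zero => simp
  | succ N ih =>
    rw [Nat.succ_mul, Finset.sum_range_add, ih fun q hq => h q (Nat.lt_succ_of_lt hq),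
      Finset.sum_range_succ, mul_add, Finset.sum_congr rfl fun r hr =>
        h N N.lt_succ_self r (Finset.mem_range.1 hr)]
    simp

/-- For sums over positions between consecutive indices: `M - 1` positions of each block are
interior to it, and one separates it from the next block, except after the last block. -/
lemma sum_range_mul_sub_one_of_div {M : ℕ} (hM : 1 ≤ M) (N : ℕ) (φ ψ χ : ℕ → ℝ)
    (h : ∀ q < N, ∀ r < M - 1, φ (q * M + r) = ψ q)
    (h' : ∀ q < N - 1, φ (q * M + (M - 1)) = χ q) :
    ∑ i ∈ Finset.range (N * M - 1), φ i =
      (M - 1) * ∑ q ∈ Finset.range N, ψ q + ∑ q ∈ Finset.range (N - 1), χ q := by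
  obtain ⟨m, rfl⟩ := Nat.exists_eq_add_of_le' hM
  simp only [Nat.add_sub_cancel] at h h'
  rcases N with _ | N
  · simp
  -- With `M = m + 1` and `N + 1` blocks, the range stops `m` steps into the last block, just before
  -- a separating position would occur.
  have hidx : (N + 1) * (m + 1) - 1 = N * (m + 1) + m := by
    rw [Nat.succ_mul]
    rfl
  rw [hidx]
  clear hidx
  simp only [Nat.add_sub_cancel] at h' ⊢
  induction N with
  | zero =>
    have := Finset.sum_congr rfl fun r hr => h 0 Nat.one_pos r (Finset.mem_range.1 hr)
    simp only [zero_mul, zero_add] at this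
    simp [this]
  | succ N ih =>
    have e : (N + 1) * (m + 1) + m = N * (m + 1) + m + 1 + m := by ring
    rw [e, Finset.sum_range_add, Finset.sum_range_succ,
      ih (fun q hq => h q (Nat.lt_succ_of_lt hq)) (fun q hq => h' q (Nat.lt_succ_of_lt hq)),
      h' N N.lt_succ_self]
    have : ∀ r ∈ Finset.range m, φ (N * (m + 1) + m + 1 + r) = ψ (N + 1) := fun r hr => by
      rw [← h (N + 1) (N + 1).lt_succ_self r (Finset.mem_range.1 hr)]
      congr 1
      ring
    rw [Finset.sum_congr rfl this, Finset.sum_range_succ ψ (N + 1), Finset.sum_range_succ χ N,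
      Finset.sum_const, Finset.card_range, nsmul_eq_mul]
    push_cast
    ring

section Recursion

variable {M : ℕ} (p : ℝ) (n : ℕ)

lemma div_of_lt {M q r : ℕ} (hr : r < M) : (q * M + r) / M = q := by
  rw [mul_comm, Nat.mul_add_div (by omega), Nat.div_eq_of_lt hr, add_zero]

lemma div_add_one_of_lt {M q r : ℕ} (hr : r < M - 1) : (q * M + r + 1) / M = q := by
  rw [add_assoc, div_of_lt (by omega)]

lemma div_last {M q : ℕ} (hM : 1 ≤ M) : (q * M + (M - 1)) / M = q :=
  div_of_lt (by omega)

lemma div_last_add_one {M q : ℕ} (hM : 1 ≤ M) : (q * M + (M - 1) + 1) / M = q + 1 := by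
  rw [add_assoc, Nat.sub_add_cancel hM, ← Nat.succ_mul, Nat.mul_div_cancel _ hM]

lemma squareSum_survProb_succ :
    squareSum (M ^ (n + 1)) (survProb M p (n + 1)) =
      p * M ^ 2 * squareSum (M ^ n) (survProb M p n) := by
  have h : squareSum (M ^ (n + 1)) (survProb M p (n + 1)) =
      M * ∑ a ∈ Finset.range (M ^ n), M * ∑ b ∈ Finset.range (M ^ n),
        p * survProb M p n {(a, b)} := by
    rw [squareSum, pow_succ]
    refine sum_range_mul_of_div _ _ _ fun a _ r hr => ?_
    refine sum_range_mul_of_div _ _ _ fun b _ s hs => ?_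
    simp [survProb, parent, div_of_lt hr, div_of_lt hs]
  rw [h, squareSum]
  simp_rw [← Finset.mul_sum]
  ring

/-- Of the neighbouring pairs, `M * (M - 1)` lie inside each parent square and `M` straddle each
pair of neighbouring parents; `p ^ 2` accounts for the last branchings. -/
lemma horizontalSum_survProb_succ (hM : 1 ≤ M) :
    horizontalSum (M ^ (n + 1)) (survProb M p (n + 1)) =
      p ^ 2 * M * ((M - 1) * squareSum (M ^ n) (survProb M p n) +
        horizontalSum (M ^ n) (survProb M p n)) := by
  have h : horizontalSum (M ^ (n + 1)) (survProb M p (n + 1)) =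
      (M - 1) * ∑ a ∈ Finset.range (M ^ n), M * ∑ b ∈ Finset.range (M ^ n),
        p ^ 2 * survProb M p n {(a, b)} +
      ∑ a ∈ Finset.range (M ^ n - 1), M * ∑ b ∈ Finset.range (M ^ n),
        p ^ 2 * survProb M p n {(a, b), (a + 1, b)} := by
    rw [horizontalSum, pow_succ]
    refine sum_range_mul_sub_one_of_div hM _ _ _ _ (fun a _ r hr => ?_) fun a _ => ?_
    · refine sum_range_mul_of_div _ _ _ fun b _ s hs => ?_
      simp [survProb, parent, div_of_lt (show r < M by omega), div_add_one_of_lt hr, div_of_lt hs,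
        Finset.image_insert]
    · refine sum_range_mul_of_div _ _ _ fun b _ s hs => ?_
      simp [survProb, parent, div_last hM, div_last_add_one hM, div_of_lt hs, Finset.image_insert]
  rw [h, squareSum, horizontalSum]
  simp_rw [← Finset.mul_sum]
  ring

lemma verticalSum_survProb_succ (hM : 1 ≤ M) :
    verticalSum (M ^ (n + 1)) (survProb M p (n + 1)) =
      p ^ 2 * M * ((M - 1) * squareSum (M ^ n) (survProb M p n) +
        verticalSum (M ^ n) (survProb M p n)) := by
  have h : verticalSum (M ^ (n + 1)) (survProb M p (n + 1)) =
      M * ∑ a ∈ Finset.range (M ^ n), ((M - 1) * ∑ b ∈ Finset.range (M ^ n),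
        p ^ 2 * survProb M p n {(a, b)} + ∑ b ∈ Finset.range (M ^ n - 1),
        p ^ 2 * survProb M p n {(a, b), (a, b + 1)}) := by
    rw [verticalSum, pow_succ]
    refine sum_range_mul_of_div _ _ _ fun a _ r hr => ?_
    refine sum_range_mul_sub_one_of_div hM _ _ _ _ (fun b _ s hs => ?_) fun b _ => ?_
    · simp [survProb, parent, div_of_lt (show s < M by omega), div_add_one_of_lt hs, div_of_lt hr,
        Finset.image_insert]
    · simp [survProb, parent, div_last hM, div_last_add_one hM, div_of_lt hr, Finset.image_insert]
  rw [h, squareSum, verticalSum]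
  simp_rw [Finset.sum_add_distrib, ← Finset.mul_sum]
  ring

lemma card_translate (T : Finset (ℕ × ℕ)) (i j : ℕ) : (translate T i j).card = T.card := by
  refine Finset.card_image_of_injective _ fun s t h => ?_
  simpa [Prod.ext_iff] using h

lemma image_parent_translate {T : Finset (ℕ × ℕ)} {i j : ℕ} {α β : ℕ → ℕ}
    (hα : ∀ t ∈ T, (i + t.1) / M = α t.1) (hβ : ∀ t ∈ T, (j + t.2) / M = β t.2) :
    (translate T i j).image (parent M) = T.image fun t => (α t.1, β t.2) := by
  rw [translate, Finset.image_image]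
  refine Finset.image_congr fun t ht => ?_
  simp only [Function.comp, parent, hα t ht, hβ t ht]

/-- When the vertex lies on an edge between two parent squares, the parents of a pattern are given
by one of its projections. Both projections being full, all seven patterns yield the same pair of
parents. -/
lemma image_fst_vertexPattern (t : Fin 7) : (vertexPattern t).image Prod.fst = {0, 1} := by
  revert t
  decide

lemma image_snd_vertexPattern (t : Fin 7) : (vertexPattern t).image Prod.snd = {0, 1} := by
  revert t
  decide

lemma vertexPattern_nonempty (t : Fin 7) : (vertexPattern t).Nonempty := by
  revert t
  decide

/-- The recursion for patterns of squares around a vertex with full projections. -/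
lemma vertexSum_survProb_succ (hM : 1 ≤ M) (t : Fin 7) :
    vertexSum (M ^ (n + 1)) (vertexPattern t) (survProb M p (n + 1)) =
      p ^ (vertexPattern t).card * ((M - 1) ^ 2 * squareSum (M ^ n) (survProb M p n) +
        (M - 1) * verticalSum (M ^ n) (survProb M p n) +
        (M - 1) * horizontalSum (M ^ n) (survProb M p n) +
        vertexSum (M ^ n) (vertexPattern t) (survProb M p n)) := by
  set c := p ^ (vertexPattern t).card with hc
  -- In each coordinate the vertex is either inside a parent (`d0`, the offset is lost) or on a
  -- boundary between parents (`d1`, the offset survives). The four combinations give a square, a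
  -- vertical pair, a horizontal pair or the same pattern.
  have d0 : ∀ {q r : ℕ}, r < M - 1 → ∀ a : ℕ, a ≤ 1 → (q * M + r + a) / M = q := by
    intro q r hr a ha
    rw [add_assoc, div_of_lt (by omega)]
  have d1 : ∀ {q : ℕ}, ∀ a : ℕ, a ≤ 1 → (q * M + (M - 1) + a) / M = q + a := by
    intro q a ha
    interval_cases a
    · exact div_last hM
    · exact div_last_add_one hM
  have hT := vertexPattern_subset t
  have p1 : ∀ a b : ℕ, (vertexPattern t).image (fun _ => (a, b)) = {(a, b)} := by
    intro a b
    exact Finset.image_const (vertexPattern_nonempty t) _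
  have p2 : ∀ a b : ℕ, (vertexPattern t).image (fun t => (a, b + t.2)) = {(a, b), (a, b + 1)} := by
    intro a b
    rw [show (fun t : ℕ × ℕ => (a, b + t.2)) = (fun s => (a, b + s)) ∘ Prod.snd from rfl,
      ← Finset.image_image, image_snd_vertexPattern]
    simp [Finset.image_insert]
  have p3 : ∀ a b : ℕ, (vertexPattern t).image (fun t => (a + t.1, b)) = {(a, b), (a + 1, b)} := by
    intro a b
    rw [show (fun t : ℕ × ℕ => (a + t.1, b)) = (fun s => (a + s, b)) ∘ Prod.fst from rfl,
      ← Finset.image_image, image_fst_vertexPattern]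
    simp [Finset.image_insert]
  have h : vertexSum (M ^ (n + 1)) (vertexPattern t) (survProb M p (n + 1)) =
      (M - 1) * ∑ a ∈ Finset.range (M ^ n),
        ((M - 1) * ∑ b ∈ Finset.range (M ^ n), c * survProb M p n {(a, b)} +
          ∑ b ∈ Finset.range (M ^ n - 1), c * survProb M p n {(a, b), (a, b + 1)}) +
      ∑ a ∈ Finset.range (M ^ n - 1),
        ((M - 1) * ∑ b ∈ Finset.range (M ^ n), c * survProb M p n {(a, b), (a + 1, b)} +
          ∑ b ∈ Finset.range (M ^ n - 1), c * survProb M p n (translate (vertexPattern t) a b)) := by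
    rw [vertexSum, pow_succ]
    refine sum_range_mul_sub_one_of_div hM _ _ _ _ (fun a _ r hr => ?_) fun a _ => ?_ <;>
    refine sum_range_mul_sub_one_of_div hM _ _ _ _ (fun b _ s hs => ?_) fun b _ => ?_ <;>
    rw [survProb, card_translate, ← hc]
    · rw [image_parent_translate (α := fun _ => a) (β := fun _ => b)
        (fun t ht => d0 hr _ (hT t ht).1) (fun t ht => d0 hs _ (hT t ht).2), p1]
    · rw [image_parent_translate (α := fun _ => a) (β := fun x => b + x)
        (fun t ht => d0 hr _ (hT t ht).1) (fun t ht => d1 _ (hT t ht).2), p2]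
    · rw [image_parent_translate (α := fun x => a + x) (β := fun _ => b)
        (fun t ht => d1 _ (hT t ht).1) (fun t ht => d0 hs _ (hT t ht).2), p3]
    · rw [image_parent_translate (α := fun x => a + x) (β := fun x => b + x)
        (fun t ht => d1 _ (hT t ht).1) (fun t ht => d1 _ (hT t ht).2), translate]
  rw [h, squareSum, verticalSum, horizontalSum, vertexSum]
  simp_rw [Finset.sum_add_distrib, ← Finset.mul_sum]
  ring

end Recursion

/-! ### Limits -/

lemma tendsto_zero_of_recursion {c : ℝ} (hc0 : 0 ≤ c) (hc1 : c < 1) {u d : ℕ → ℝ}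
    (hu : ∀ n, u (n + 1) = c * u n + d n) (hd : Tendsto d atTop (𝓝 0)) :
    Tendsto u atTop (𝓝 0) := by
  rw [Metric.tendsto_atTop]
  intro ε hε
  -- The tolerance makes `ε / 2` the fixed point of `x ↦ c * x + ε / 2 * (1 - c)`.
  obtain ⟨m, hm⟩ := Metric.tendsto_atTop.1 hd (ε / 2 * (1 - c))
    (mul_pos (half_pos hε) (sub_pos.2 hc1))
  have bound : ∀ k, |u (m + k)| ≤ c ^ k * |u m| + ε / 2 := by
    intro k
    induction k with
    | zero => simpa using (half_pos hε).le
    | succ k ih =>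
      have h1 := hm (m + k) (Nat.le_add_right _ _)
      rw [Real.dist_eq, sub_zero] at h1
      rw [← add_assoc, hu]
      calc |c * u (m + k) + d (m + k)| ≤ c * |u (m + k)| + |d (m + k)| := by
            refine (abs_add_le _ _).trans ?_
            rw [abs_mul, abs_of_nonneg hc0]
        _ ≤ c * (c ^ k * |u m| + ε / 2) + ε / 2 * (1 - c) :=
            add_le_add (mul_le_mul_of_nonneg_left ih hc0) h1.le
        _ = c ^ (k + 1) * |u m| + ε / 2 := by ring
  have hpow : Tendsto (fun k => c ^ k * |u m|) atTop (𝓝 0) := by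
    simpa using (tendsto_pow_atTop_nhds_zero_of_lt_one hc0 hc1).mul_const |u m|
  obtain ⟨K, hK⟩ := (hpow.eventually (gt_mem_nhds (half_pos hε))).exists_forall_of_atTop
  refine ⟨m + K, fun n hn => ?_⟩
  obtain ⟨k, rfl⟩ := Nat.exists_eq_add_of_le (le_trans (Nat.le_add_right m K) hn)
  rw [Real.dist_eq, sub_zero]
  have := hK k (by omega)
  linarith [bound k]

/-- The limit is the fixed point of `x ↦ c * (β + x)`; the deviation from it satisfies a contracting
recursion with vanishing perturbation. -/
lemma tendsto_of_recursion {c β : ℝ} (hc0 : 0 ≤ c) (hc1 : c < 1) {u b : ℕ → ℝ}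
    (hu : ∀ n, u (n + 1) = c * (b n + u n)) (hb : Tendsto b atTop (𝓝 β)) :
    Tendsto u atTop (𝓝 (c * β / (1 - c))) := by
  have h : Tendsto (fun n => u n - c * β / (1 - c)) atTop (𝓝 0) := by
    refine tendsto_zero_of_recursion hc0 hc1 (d := fun n => c * (b n - β)) (fun n => ?_) ?_
    · have : 1 - c ≠ 0 := (sub_pos.2 hc1).ne'
      rw [hu]
      field_simp
      ring
    · simpa using (hb.sub_const β).const_mul c
  simpa using h.add_const (c * β / (1 - c))

/-- Since `M ^ D = M² p`, the rescaling divides by the expected number of squares and measures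
length in units of the mesh. -/
lemma rescaling_factor {M : ℕ} (hM : 2 ≤ M) {p : ℝ} (hp : 0 < p) (k n : ℕ) :
    (1 / (M : ℝ)) ^ ((n : ℝ) * (dimD 2 M p - (k : ℝ))) =
      ((M : ℝ) ^ n) ^ k / ((M : ℝ) ^ 2 * p) ^ n := by
  have hM0 : (0 : ℝ) < M := by positivity
  have hlog : Real.log M ≠ 0 := (Real.log_pos (by exact_mod_cast hM)).ne'
  have hD : (M : ℝ) ^ dimD 2 M p = (M : ℝ) ^ 2 * p := by
    rw [Real.rpow_def_of_pos hM0, dimD, mul_div_cancel₀ _ hlog, Real.exp_log (by positivity)]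
  rw [one_div, Real.inv_rpow hM0.le, ← Real.rpow_neg hM0.le,
    show -((n : ℝ) * (dimD 2 M p - k)) = (n * k : ℕ) - dimD 2 M p * n by push_cast; ring,
    Real.rpow_sub hM0, Real.rpow_natCast, Real.rpow_mul hM0.le, hD, Real.rpow_natCast, pow_mul]

section NormalizedLimits

variable {M : ℕ} {p : ℝ}

lemma squareSum_survProb (n : ℕ) :
    squareSum (M ^ n) (survProb M p n) = ((M : ℝ) ^ 2 * p) ^ n := by
  induction n with
  | zero => simp [squareSum, survProb]
  | succ n ih =>
    rw [squareSum_survProb_succ, ih]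
    ring

/-- The limit of the normalized expected number of pairs of adjacent surviving squares. -/
lemma tendsto_of_adjacent_recursion (hM : 2 ≤ M) (hp : 0 < p) (hp1 : p ≤ 1) {h : ℕ → ℝ}
    (hs : ∀ n, h (n + 1) = p ^ 2 * M * ((M - 1) * ((M : ℝ) ^ 2 * p) ^ n + h n)) :
    Tendsto (fun n => h n / ((M : ℝ) ^ 2 * p) ^ n) atTop (𝓝 (p * (M - 1) / (M - p))) := by
  have hM2 : (2 : ℝ) ≤ M := by exact_mod_cast hM
  have hM0 : (0 : ℝ) < M := by linarith
  have hMp : (M : ℝ) - p ≠ 0 := by linarith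
  -- The ratio is `p² M / (M² p)`.
  have := tendsto_of_recursion (c := p / M) (by positivity) ((div_lt_one hM0).2 (by linarith))
    (u := fun n => h n / ((M : ℝ) ^ 2 * p) ^ n) (b := fun _ => (M : ℝ) - 1) (fun n => ?_)
    tendsto_const_nhds
  · convert this using 2
    field_simp
  · simp only [hs]
    field_simp
    ring

/-- The limit of the normalized expected number of occurrences of a pattern of `t` surviving squares
around a vertex. -/
lemma tendsto_of_vertex_recursion (hM : 2 ≤ M) (hp : 0 < p) (hp1 : p ≤ 1) {t : ℕ} (ht : 1 ≤ t)
    {v h y : ℕ → ℝ}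
    (hv : Tendsto (fun n => v n / ((M : ℝ) ^ 2 * p) ^ n) atTop (𝓝 (p * (M - 1) / (M - p))))
    (hh : Tendsto (fun n => h n / ((M : ℝ) ^ 2 * p) ^ n) atTop (𝓝 (p * (M - 1) / (M - p))))
    (hy : ∀ n, y (n + 1) = p ^ t * ((M - 1) ^ 2 * ((M : ℝ) ^ 2 * p) ^ n + (M - 1) * v n +
      (M - 1) * h n + y n)) :
    Tendsto (fun n => y n / ((M : ℝ) ^ 2 * p) ^ n) atTop
      (𝓝 (p ^ (t - 1) * ((M - 1) ^ 2 * (M + p)) / ((M - p) * (M ^ 2 - p ^ (t - 1))))) := by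
  have hM2 : (2 : ℝ) ≤ M := by exact_mod_cast hM
  have hM0 : (0 : ℝ) < M := by linarith
  have hMp : (M : ℝ) - p ≠ 0 := by linarith
  obtain ⟨t, rfl⟩ := Nat.exists_eq_add_of_le' ht
  rw [Nat.add_sub_cancel]
  have hpt : p ^ t ≤ 1 := pow_le_one₀ hp.le hp1
  have hMt : (M : ℝ) ^ 2 - p ^ t ≠ 0 := by nlinarith
  -- After the shift of `t` the ratio is `p ^ (t + 1) / (M² p)`; the inhomogeneity tends to `(M -
  -- 1)² + 2p(M - 1)²/(M - p) = (M - 1)²(M + p)/(M - p)`.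
  have := tendsto_of_recursion (c := p ^ t / M ^ 2) (by positivity)
    ((div_lt_one (by positivity)).2 (by nlinarith))
    (u := fun n => y n / ((M : ℝ) ^ 2 * p) ^ n)
    (b := fun n => ((M : ℝ) - 1) ^ 2 + (M - 1) * (v n / ((M : ℝ) ^ 2 * p) ^ n) +
      (M - 1) * (h n / ((M : ℝ) ^ 2 * p) ^ n)) (fun n => ?_)
    (((hv.const_mul _).const_add _).add (hh.const_mul _))
  · convert this using 2
    field_simp
    ring
  · simp only [hy]
    field_simp
    ring

end NormalizedLimits

end FractalPercolation

/-! ### The limits for area, boundary length and Euler characteristic -/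

open FractalPercolation in
theorem theorem2 {Ω : Type*} [MeasurableSpace Ω] (P : Measure Ω) [IsProbabilityMeasure P]
    (M : ℕ) (hM : 2 ≤ M) (p : ℝ) (hp : 1 / (M : ℝ) ^ 2 < p) (hp1 : p ≤ 1)
    (keep : List (FractalPercolation.Letter 2 M) → FractalPercolation.Letter 2 M → Set Ω)
    (hkeep : FractalPercolation.IsPercolation P p keep) :
    (∀ (k : Fin 3) (n : ℕ), Integrable
      (fun ω => FractalPercolation.intrinsicVolume k (FractalPercolation.step keep n ω)) P) ∧
    Tendsto (FractalPercolation.rescaledVolume P p keep 2) atTop (𝓝 1) ∧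
    Tendsto (FractalPercolation.rescaledVolume P p keep 1) atTop
      (𝓝 (2 * M * (1 - p) / (M - p))) ∧
    Tendsto (FractalPercolation.rescaledVolume P p keep 0) atTop
      (𝓝 (1 - 2 * p * ((M : ℝ) - 1) ^ 2 / (M - p) *
            (3 / (M - 1) - 4 * p / (M - p) + p ^ 2 / (M - p ^ 2))
          + 2 * p * ((M : ℝ) ^ 2 - 1) / (M ^ 2 - p)
          - 4 * p ^ 2 * ((M : ℝ) - 1) ^ 2 / (M - p) ^ 2
          + p ^ 3 * ((M : ℝ) - 1) ^ 2 * (M + p ^ 2) / ((M - p ^ 2) * (M ^ 2 - p ^ 3)))) := by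
  have : NeZero M := ⟨by omega⟩
  have hM2 : (2 : ℝ) ≤ M := by exact_mod_cast hM
  have hM0 : (0 : ℝ) < M := by linarith
  have hp0 : 0 < p := lt_trans (by positivity) hp
  have hM1 : 1 ≤ M := by omega
  have hMp : (M : ℝ) - p ≠ 0 := by linarith
  simp only [intrinsicVolume_step]
  have hresc : ∀ k : Fin 3, rescaledVolume P p keep k = fun n =>
      ((M : ℝ) ^ n) ^ (k : ℕ) / ((M : ℝ) ^ 2 * p) ^ n *
        gridVolume (M ^ n) (survProb M p n) k := by
    intro k
    ext n
    simp only [rescaledVolume, intrinsicVolume_step]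
    rw [hkeep.integral_gridVolume hp0.le, rescaling_factor hM hp0]
  have lh := tendsto_of_adjacent_recursion hM hp0 hp1
    (h := fun n => horizontalSum (M ^ n) (survProb M p n)) fun n => by
      rw [horizontalSum_survProb_succ p n hM1, squareSum_survProb]
  have lv := tendsto_of_adjacent_recursion hM hp0 hp1
    (h := fun n => verticalSum (M ^ n) (survProb M p n)) fun n => by
      rw [verticalSum_survProb_succ p n hM1, squareSum_survProb]
  have ly := fun t : Fin 7 => tendsto_of_vertex_recursion hM hp0 hp1
    (vertexPattern_nonempty t).card_pos lv lh
    (y := fun n => vertexSum (M ^ n) (vertexPattern t) (survProb M p n)) fun n => by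
      rw [vertexSum_survProb_succ p n hM1, squareSum_survProb]
  refine ⟨fun k n => hkeep.integrable_gridVolume n k, ?_, ?_, ?_⟩
  · rw [hresc]
    convert (tendsto_const_nhds (x := (1 : ℝ)) (f := atTop (α := ℕ))) using 2 with n
    simp [gridVolume, squareSum_survProb]
    field_simp
  · rw [hresc]
    convert (tendsto_const_nhds (x := (2 : ℝ)) (f := atTop (α := ℕ))).sub (lh.add lv) using 2
      with n
    · simp [gridVolume, squareSum_survProb]
      field_simp
      ring
    · field_simp
      ring
  · rw [hresc]
    have hcard : ∀ t, (vertexPattern t).card = ![2, 2, 3, 3, 3, 3, 4] t := by decide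
    convert (((tendsto_const_nhds (x := (1 : ℝ)) (f := atTop (α := ℕ))).sub lh).sub lv).add
      (tendsto_finsetSum Finset.univ fun t _ =>
        (ly t).const_mul ((-1) ^ ((vertexPattern t).card + 1))) using 2 with n
    · simp only [gridVolume, squareSum_survProb, Pi.add_apply, Pi.sub_apply, Pi.smul_apply,
        smul_eq_mul, Matrix.cons_val_zero, mul_one, Fin.val_zero, pow_zero, mul_div_assoc']
      rw [← Finset.sum_div]
      field_simp
    · have hp2 : p ^ 2 ≤ 1 := pow_le_one₀ hp0.le hp1
      have hp3 : p ^ 3 ≤ 1 := pow_le_one₀ hp0.le hp1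
      have d1 : (M : ℝ) - 1 ≠ 0 := by linarith
      -- This denominator occurs only in the stated closed form, where it cancels because `(M +
      -- p²)(M - p) - 2(M² - p³) = -(M + p)(M - p²)`.
      have d2 : (M : ℝ) - p ^ 2 ≠ 0 := by linarith
      have d3 : (M : ℝ) ^ 2 - p ≠ 0 := by nlinarith
      have d4 : (M : ℝ) ^ 2 - p ^ 3 ≠ 0 := by nlinarith
      -- The four triples have denominator `M² - p²`; its factor `M + p` cancels, which leaves the
      -- term with `(M - p) ^ 2`.
      have d5 : (M : ℝ) ^ 2 - p ^ 2 = (M - p) * (M + p) := by ring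
      have d6 : (M : ℝ) + p ≠ 0 := by positivity
      simp only [hcard, Fin.sum_univ_seven]
      simp [d5, pow_succ (-1 : ℝ)]
      field_simp
      ring
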